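/- Let $\sigma,\beta,c,b>0$ and $0<\alpha<1$. For $C>0$, let $\mathcal{TS}(\alpha,\beta,C)$ denote the driftless infinitely divisible law on $[0,\infty)$ whose Lévy measure has density $C\,e^{-\beta x}x^{-1-\alpha}$, $x>0$. A $\mathcal{TS}$ subordinator with parameters $(\alpha,\beta,c)$ is a subordinator $L$ with $L(t)\sim\mathcal{TS}(\alpha,\beta,ct)$ for all $t$. Let $Y(t)=\sigma W(L(t))$, where $L$ is such a subordinator and $W$ is a standard Brownian motion independent of $L$ (a symmetric normal tempered stable process); $\mathcal{SNTS}(\sigma,\alpha,\beta,ct)$ denotes the law of $Y(t)$. Let $N_0$ be a real random variable independent of the process $Y$ and let $$N(t)=e^{-bt}N_0+\int_0^te^{-b(t-s)}\,dY(s),\qquad t\ge 0,$$ be the Ornstein--Uhlenbeck process driven by $Y$ with $N(0)=N_0$ a.s. Fix $t>0$ and put $a=e^{-bt}$, $\omega=a^2$. Then $$N(t)\stackrel{d}{=}a\,N_0+N_1+N_2,$$ where the three summands on the right are independent ($N_0$ there stands for a copy of the initial value) and have the following laws. 1. $N_1=\sigma\sqrt{M_1}\,X_1$ with $X_1\sim\mathcal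 N(0,1)$ and $M_1\sim\mathcal{TS}\bigl(\alpha,\tfrac{\beta}{\omega},c\,\tfrac{1-\omega^\alpha}{2\alpha b}\bigr)$ independent; hence $N_1\sim\mathcal{SNTS}\bigl(\sigma,\alpha,\tfrac{\beta}{\omega},c\,\tfrac{1-\omega^\alpha}{2\alpha b}\bigr)$. 2. $N_2=\sigma\sqrt{M_2}\,X_2$ with $X_2\sim\mathcal N(0,1)$ and $M_2$ independent of each other and of $(X_1,M_1)$, where $M_2=\sum_{k=1}^{P_\omega}J_k$ is compound Poisson: $P_\omega$ is Poisson with parameter $$\Lambda_\omega=\frac{c\,\beta^\alpha\,\Gamma(1-\alpha)}{2b\alpha^2\omega^\alpha}\bigl(1-\omega^\alpha+\omega^\alpha\log\omega^\alpha\bigr)>0,$$ and $J_1,J_2,\dots$ are i.i.d., independent of $P_\omega$, with probability density, for $x>0$, $$f_J(x)=\frac{\alpha\,\omega^\alpha}{1-\omega^\alpha+\omega^\alpha\log\omega^\alpha}\int_1^{1/\omega}\frac{x^{-\alpha}(\beta v)^{1-\alpha}e^{-\beta vx}}{\Gamma(1-\alpha)}\,\frac{v^\alpha-1}{v}\,dv.$$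 That is, the law of $J_k$ is the mixture of the gamma laws with shape $1-\alpha$ and rate $\beta V$, where the random variable $V$ has the probability density $$f_V(v)=\frac{\alpha\,\omega^\alpha}{1-\omega^\alpha+\omega^\alpha\log\omega^\alpha}\,\frac{v^\alpha-1}{v},\qquad 1\le v\le \tfrac1\omega.$$ The variables $N_0,X_1,M_1,X_2,P_\omega,J_1,J_2,\dots$ on the right-hand side are jointly independent. -/

import Mathlib

open MeasureTheory ProbabilityTheory Filter Topology
open scoped NNReal ENNReal

universe u

/-- A real-valued Lévy process. -/
structure IsLevyProcess {Ω : Type*} [MeasurableSpace Ω] (X : ℝ≥0 → Ω → ℝ) (P : Measure Ω) :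
    Prop where
  measurable : ∀ t, Measurable (X t)
  zero : ∀ᵐ ω ∂P, X 0 ω = 0
  indep_increments : HasIndepIncrements X P
  stationary_increments : ∀ s t, IdentDistrib (fun ω ↦ X (s + t) ω - X s ω) (X t) P P
  /-- The paths are right-continuous with left limits. -/
  cadlag : ∀ᵐ ω ∂P, ∀ t, ContinuousWithinAt (fun s ↦ X s ω) (Set.Ici t) t ∧
    ∃ l, Tendsto (fun s ↦ X s ω) (𝓝[<] t) (𝓝 l)

/-- The tempered stable Lévy density `c e^{-βx} / x^{1+α}` on the positive half-line. -/
noncomputable def tsLevyDensity (α β c x : ℝ) : ℝ :=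
  if 0 < x then c * Real.exp (-β * x) / x ^ (1 + α) else 0

/-- `μ` is the tempered stable law `TS(α, β, c)`: the infinitely divisible law on the nonnegative
half-line without drift whose Lévy measure has density `tsLevyDensity α β c`. As usual for laws of
subordinators, the Lévy measure is read off from the Laplace transform (Lévy-Khintchine). -/
structure IsTSLaw (α β c : ℝ) (μ : Measure ℝ) : Prop where
  isProbabilityMeasure : IsProbabilityMeasure μ
  nonneg : ∀ᵐ x ∂μ, 0 ≤ x
  laplace : ∀ r : ℝ, 0 ≤ r → ∫ x, Real.exp (-r * x) ∂μ =
    Real.exp (-∫ x in Set.Ioi 0, (1 - Real.exp (-r * x)) * tsLevyDensity α β c x)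

/-- `L` is a tempered stable subordinator: a Lévy process with non-decreasing paths such that
`L t` has law `TS(α, β, c t)`, i.e. a pure jump process with Lévy density
`tsLevyDensity α β c`. -/
structure IsTSSubordinator {Ω : Type*} [MeasurableSpace Ω] (α β c : ℝ) (L : ℝ≥0 → Ω → ℝ≥0)
    (P : Measure Ω) : Prop where
  isLevyProcess : IsLevyProcess (fun t ω ↦ (L t ω : ℝ)) P
  monotone : ∀ᵐ ω ∂P, Monotone (fun t ↦ L t ω)
  law : ∀ t : ℝ≥0, IsTSLaw α β (c * t) (P.map (fun ω ↦ (L t ω : ℝ)))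

/-- `Y` is a symmetric normal tempered stable process: `Y t = σ W (L t)` for a standard Brownian
motion `W` and an independent tempered stable subordinator `L`. -/
def IsSNTSProcess {Ω : Type*} [MeasurableSpace Ω] (σ α β c : ℝ) (Y : ℝ≥0 → Ω → ℝ)
    (P : Measure Ω) : Prop :=
  ∃ (L : ℝ≥0 → Ω → ℝ≥0) (W : ℝ≥0 → Ω → ℝ),
    IsTSSubordinator α β c L P ∧
    (∀ t, Measurable (W t)) ∧ IsBrownianReal W P ∧
    IndepFun (fun ω t ↦ L t ω) (fun ω t ↦ W t ω) P ∧
    ∀ t ω, Y t ω = σ * W (L t ω) ω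

/-- `μ` is the law `SNTS(σ, α, β, c)`, the law at time `1` of a symmetric normal tempered stable
process with parameters `σ, α, β, c`. -/
def IsSNTSLaw (σ α β c : ℝ) (μ : Measure ℝ) : Prop :=
  ∃ (Ω : Type u) (_ : MeasurableSpace Ω) (P : Measure Ω) (Y : ℝ≥0 → Ω → ℝ),
    IsProbabilityMeasure P ∧ IsSNTSProcess σ α β c Y P ∧ HasLaw (Y 1) μ P

/-- `Z` is the stochastic integral `∫₀ᵗ f(s) dY(s)` of a continuous deterministic function `f`:
the limit in probability of the left-endpoint sums along every sequence of partitions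
`0 = τ m 0 ≤ τ m 1 ≤ … ≤ τ m (n m) = t` of `[0, t]` with mesh tending to `0`. -/
def IsStochIntegral {Ω : Type*} [MeasurableSpace Ω] (f : ℝ≥0 → ℝ) (Y : ℝ≥0 → Ω → ℝ) (t : ℝ≥0)
    (Z : Ω → ℝ) (P : Measure Ω) : Prop :=
  ∀ (n : ℕ → ℕ) (τ : ℕ → ℕ → ℝ≥0), (∀ m, Monotone (τ m)) → (∀ m, τ m 0 = 0) →
    (∀ m, τ m (n m) = t) →
    (∀ ε : ℝ, 0 < ε → ∀ᶠ m in atTop, ∀ i < n m, (τ m (i + 1) : ℝ) - τ m i ≤ ε) →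
    TendstoInMeasure P
      (fun m ω ↦ ∑ i ∈ Finset.range (n m), f (τ m i) * (Y (τ m (i + 1)) ω - Y (τ m i) ω)) atTop Z

/-- `N` is the Ornstein-Uhlenbeck process with rate `b`, driver `Y` and initial value `N₀`, that
is, `N t = e^{-bt} N₀ + ∫₀ᵗ e^{-b(t-s)} dY(s)` with `N 0 = N₀` almost surely. -/
structure IsOUProcess {Ω : Type*} [MeasurableSpace Ω] (b : ℝ) (Y : ℝ≥0 → Ω → ℝ) (N₀ : Ω → ℝ)
    (N : ℝ≥0 → Ω → ℝ) (P : Measure Ω) : Prop where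
  aemeasurable : ∀ t, AEMeasurable (N t) P
  initial : ∀ᵐ ω ∂P, N 0 ω = N₀ ω
  solution : ∀ t : ℝ≥0, IsStochIntegral (fun s ↦ Real.exp (-b * ((t : ℝ) - s))) Y t
    (fun ω ↦ N t ω - Real.exp (-b * t) * N₀ ω) P

/-- The Poisson parameter `Λ_ω`. -/
noncomputable def poissonIntensity (α β c b w : ℝ) : ℝ :=
  c * β ^ α * Real.Gamma (1 - α) / (2 * b * α ^ 2 * w ^ α) *
    (1 - w ^ α + w ^ α * Real.log (w ^ α))

/-- The density `f_V` of the random rate. -/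
noncomputable def rateDensity (α w v : ℝ) : ℝ :=
  if 1 ≤ v ∧ v ≤ 1 / w then
    α * w ^ α / (1 - w ^ α + w ^ α * Real.log (w ^ α)) * ((v ^ α - 1) / v)
  else 0

/-- The density `f_J` of the jumps. -/
noncomputable def jumpDensity (α β w x : ℝ) : ℝ :=
  if 0 < x then
    α * w ^ α / (1 - w ^ α + w ^ α * Real.log (w ^ α)) *
      ∫ v in (1 : ℝ)..(1 / w),
        x ^ (-α) * (β * v) ^ (1 - α) * Real.exp (-β * v * x) / Real.Gamma (1 - α) *
          ((v ^ α - 1) / v)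
  else 0

/-- The law with density `f_V`. -/
noncomputable def rateLaw (α w : ℝ) : Measure ℝ :=
  volume.withDensity fun v ↦ ENNReal.ofReal (rateDensity α w v)

/-- The law with density `f_J`. -/
noncomputable def jumpLaw (α β w : ℝ) : Measure ℝ :=
  volume.withDensity fun x ↦ ENNReal.ofReal (jumpDensity α β w x)

/-!
Both sides of the identity in law are compared through characteristic functions, and every one of
them is a Laplace transform evaluated at `r = (uσ)² / 2`, because Brownian motion at independent
random times and the variables `σ √M X` are Gaussian conditionally on the times, respectively on
`M` (`integral_cexp_sum_comp_time`, `integral_cexp_sqrt_mul_gaussian`).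

Write `ψ` for the Laplace exponent of `TS(α, β, 1)`, which integration by parts in the
Lévy-Khintchine integral identifies as `ψ(r) = Γ(1-α)/α * ((β + r)^α - β^α)`
(`integral_one_sub_exp_mul_tsLevyDensity`). Conditioning on the subordinator, the left-endpoint
sums that approximate the stochastic integral have characteristic functions whose exponents are
Riemann sums, so `N t` has the characteristic function of `a N₀` times
`exp (-c ∫₀ᵗ ψ(r e^{-2bs}) ds)` (`IsOUProcess.integral_cexp`). On the other side, the
variances of `N₁` and `N₂` contribute the exponents `c (1 - w^α) / (2αb) * ψ_{β/w}(r)` and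
`Λ (1 - E e^{-rJ})` (`integral_exp_compoundPoisson`), where the Laplace transform of `J` is
computed from its representation as a mixture of gamma laws, a consequence of Tonelli's theorem
(`lintegral_jumpLaw`, `integral_exp_jumpLaw`).

The theorem is thus the identity `integral_tsExponent_eq_add` between exponents. With
`z = e^{2bt}`, so that `w = 1/z`, its right-hand side is an explicit function of `t` which
vanishes at `t = 0` and whose derivative is `c ψ(r e^{-2bt})` (`hasDerivAt_tsExponent_primitive`).

No Lévy process has to be constructed: if `L` is the given subordinator, `w L(s t)` is again a
tempered stable subordinator, with rate `β / w`, and a suitable `s` gives any required intensity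
(`IsTSSubordinator.scale`, `IsSNTSProcess.exists_isTSLaw`). This provides the law of `M₁` and
shows that `N₁` has a symmetric normal tempered stable law. The building blocks live on a
countable product of real lines (`blockMeasure`).
-/

/-! ### The Laplace exponent of the tempered stable law -/

/-- The Laplace exponent `Γ(1-α)/α * ((β + r)^α - β^α)` of `TS(α, β, 1)`. -/
noncomputable def tsExponent (α β r : ℝ) : ℝ :=
  Real.Gamma (1 - α) / α * ((β + r) ^ α - β ^ α)

lemma integrableOn_rpow_neg_mul_exp {α κ : ℝ} (hα1 : α < 1) (hκ : 0 < κ) :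
    IntegrableOn (fun x : ℝ ↦ x ^ (-α) * Real.exp (-κ * x)) (Set.Ioi 0) :=
  integrableOn_rpow_mul_exp_neg_mul_rpow (s := -α) (p := 1) (by linarith) one_pos hκ |>.congr_fun
    (fun x _ ↦ by simp) measurableSet_Ioi

lemma integral_rpow_neg_mul_exp {α κ : ℝ} (hα1 : α < 1) (hκ : 0 < κ) :
    ∫ x : ℝ in Set.Ioi 0, x ^ (-α) * Real.exp (-κ * x) = Real.Gamma (1 - α) * κ ^ (α - 1) := by
  have h := Real.integral_rpow_mul_exp_neg_mul_Ioi (a := 1 - α) (by linarith) hκ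
  rw [show (1 - α - 1 : ℝ) = -α by ring] at h
  simp only [neg_mul]
  rw [h, one_div, Real.inv_rpow hκ.le, ← Real.rpow_neg hκ.le, mul_comm]
  ring_nf

lemma exp_sub_exp_le {β r x : ℝ} :
    Real.exp (-β * x) - Real.exp (-(β + r) * x) ≤ r * x * Real.exp (-β * x) := by
  have h := Real.add_one_le_exp (-(r * x))
  have h2 : Real.exp (-(β + r) * x) = Real.exp (-β * x) * Real.exp (-(r * x)) := by
    rw [← Real.exp_add]; ring_nf
  rw [h2]
  nlinarith [Real.exp_pos (-β * x)]

lemma integrableOn_rpow_mul_exp_sub_exp {α β r : ℝ} (hα1 : α < 1) (hβ : 0 < β) (hr : 0 ≤ r) :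
    IntegrableOn (fun x : ℝ ↦ x ^ (-α - 1) * (Real.exp (-β * x) - Real.exp (-(β + r) * x)))
      (Set.Ioi 0) := by
  refine ((integrableOn_rpow_neg_mul_exp hα1 hβ).const_mul r).mono'
    (by fun_prop) ?_
  refine (ae_restrict_mem measurableSet_Ioi).mono fun x (hx : 0 < x) ↦ ?_
  have h0 : 0 ≤ Real.exp (-β * x) - Real.exp (-(β + r) * x) := by
    rw [sub_nonneg, Real.exp_le_exp]; nlinarith
  have hp : 0 < x ^ (-α - 1) := Real.rpow_pos_of_pos hx _
  rw [Real.norm_of_nonneg (mul_nonneg hp.le h0)]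
  calc _ ≤ x ^ (-α - 1) * (r * x * Real.exp (-β * x)) :=
        mul_le_mul_of_nonneg_left exp_sub_exp_le hp.le
    _ = r * ((x ^ (-α - 1) * x) * Real.exp (-β * x)) := by ring
    _ = _ := by rw [← Real.rpow_add_one hx.ne']; ring_nf

/-- Integration by parts against `-x^{-α}/α` turns the Lévy integral into two gamma integrals. -/
lemma integral_rpow_mul_exp_sub_exp {α β r : ℝ} (hα0 : 0 < α) (hα1 : α < 1) (hβ : 0 < β)
    (hr : 0 ≤ r) :
    ∫ x : ℝ in Set.Ioi 0, x ^ (-α - 1) * (Real.exp (-β * x) - Real.exp (-(β + r) * x)) =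
      tsExponent α β r := by
  set E : ℝ → ℝ := fun x ↦ Real.exp (-β * x) - Real.exp (-(β + r) * x) with hE
  have hE0 : ∀ x, 0 < x → 0 ≤ E x := fun x hx ↦ by
    simp only [hE]; rw [sub_nonneg, Real.exp_le_exp]; nlinarith
  have hbr : 0 < β + r := by linarith
  have hcont : ContinuousWithinAt (fun x : ℝ ↦ x ^ (-α) * E x) (Set.Ici 0) 0 := by
    rw [← Set.Ioi_insert, continuousWithinAt_insert_self]
    have : (0 : ℝ) ^ (-α) * E 0 = 0 := by simp [hE]
    rw [ContinuousWithinAt, this]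
    have hlim : Tendsto (fun x : ℝ ↦ r * x ^ (1 - α)) (𝓝[>] 0) (𝓝 0) := by
      have : ContinuousAt (fun x : ℝ ↦ r * x ^ (1 - α)) 0 :=
        continuousAt_const.mul (Real.continuousAt_rpow_const _ _ (Or.inr (by linarith)))
      have h2 := this.tendsto
      rw [Real.zero_rpow (by linarith), mul_zero] at h2
      exact h2.mono_left nhdsWithin_le_nhds
    refine tendsto_of_tendsto_of_tendsto_of_le_of_le' tendsto_const_nhds hlim ?_ ?_
    · filter_upwards [self_mem_nhdsWithin] with x (hx : 0 < x)
      exact mul_nonneg (Real.rpow_nonneg hx.le _) (hE0 x hx)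
    · filter_upwards [self_mem_nhdsWithin] with x (hx : 0 < x)
      have h1 : E x ≤ r * x := exp_sub_exp_le.trans
        (mul_le_of_le_one_right (by positivity) (Real.exp_le_one_iff.2 (by nlinarith)))
      calc x ^ (-α) * E x ≤ x ^ (-α) * (r * x) :=
            mul_le_mul_of_nonneg_left h1 (Real.rpow_nonneg hx.le _)
        _ = r * (x ^ (-α) * x) := by ring
        _ = r * x ^ (1 - α) := by rw [← Real.rpow_add_one hx.ne']; ring_nf
  have hderiv : ∀ x ∈ Set.Ioi (0 : ℝ), HasDerivAt (fun x : ℝ ↦ x ^ (-α) * E x)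
      (-α * (x ^ (-α - 1) * E x) + (-β * (x ^ (-α) * Real.exp (-β * x)) +
        (β + r) * (x ^ (-α) * Real.exp (-(β + r) * x)))) x := by
    intro x (hx : 0 < x)
    have h1 := Real.hasDerivAt_rpow_const (x := x) (p := -α) (Or.inl hx.ne')
    have h2 : HasDerivAt E (Real.exp (-β * x) * (-β) - Real.exp (-(β + r) * x) * (-(β + r))) x := by
      have e : ∀ k : ℝ, HasDerivAt (fun x ↦ Real.exp (k * x)) (Real.exp (k * x) * k) x := fun k ↦ by
        simpa using ((hasDerivAt_id x).const_mul k).exp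
      exact (e _).sub (e _)
    convert! h1.mul h2 using 1
    ring
  have i1 := integrableOn_rpow_mul_exp_sub_exp hα1 hβ hr
  have i2 := integrableOn_rpow_neg_mul_exp hα1 hβ
  have i3 := integrableOn_rpow_neg_mul_exp hα1 hbr
  have hinf : Tendsto (fun x : ℝ ↦ x ^ (-α) * E x) atTop (𝓝 0) := by
    have e : ∀ k : ℝ, 0 < k → Tendsto (fun x ↦ Real.exp (-k * x)) atTop (𝓝 0) := fun k hk ↦ by
      have := Real.tendsto_exp_neg_atTop_nhds_zero.comp (tendsto_id.const_mul_atTop hk)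
      simpa [Function.comp_def] using this
    simpa only [sub_self, mul_zero] using
      (tendsto_rpow_neg_atTop hα0).mul ((e β hβ).sub (e (β + r) hbr))
  have key := integral_Ioi_of_hasDerivAt_of_tendsto hcont hderiv
    ((i1.const_mul _).add ((i2.const_mul _).add (i3.const_mul _))) hinf
  have i23 : IntegrableOn (fun x : ℝ ↦ -β * (x ^ (-α) * Real.exp (-β * x)) +
      (β + r) * (x ^ (-α) * Real.exp (-(β + r) * x))) (Set.Ioi 0) :=
    (i2.const_mul _).add (i3.const_mul _)
  rw [integral_add (i1.const_mul _) i23,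
    integral_add (i2.const_mul _) (i3.const_mul _), integral_const_mul, integral_const_mul,
    integral_const_mul, integral_rpow_neg_mul_exp hα1 hβ, integral_rpow_neg_mul_exp hα1 hbr] at key
  have p : ∀ k : ℝ, 0 < k → k ^ α = k * k ^ (α - 1) := fun k hk ↦ by
    rw [mul_comm, ← Real.rpow_add_one hk.ne']; ring_nf
  simp only [hE, mul_zero, Real.exp_zero, sub_self] at key
  rw [tsExponent, p β hβ, p _ hbr, div_mul_eq_mul_div, eq_div_iff hα0.ne']
  linarith

lemma integral_one_sub_exp_mul_tsLevyDensity {α β c r : ℝ} (hα0 : 0 < α) (hα1 : α < 1)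
    (hβ : 0 < β) (hr : 0 ≤ r) :
    ∫ x in Set.Ioi 0, (1 - Real.exp (-r * x)) * tsLevyDensity α β c x =
      c * tsExponent α β r := by
  rw [← integral_rpow_mul_exp_sub_exp hα0 hα1 hβ hr, ← integral_const_mul]
  refine setIntegral_congr_fun measurableSet_Ioi fun x (hx : 0 < x) ↦ ?_
  have h2 : Real.exp (-(β + r) * x) = Real.exp (-r * x) * Real.exp (-β * x) := by
    rw [← Real.exp_add]; ring_nf
  simp only [tsLevyDensity, if_pos hx, h2]
  rw [show (-α - 1 : ℝ) = -(1 + α) by ring, Real.rpow_neg hx.le]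
  ring

/-- Change of scale: dilating the argument and the rate by `w` multiplies the exponent by `w^α`. -/
lemma tsExponent_mul {α β r w : ℝ} (hβ : 0 < β) (hr : 0 ≤ r) (hw : 0 < w) :
    tsExponent α β (w * r) = w ^ α * tsExponent α (β / w) r := by
  have h1 : β + w * r = w * (β / w + r) := by field_simp
  have h2 : β ^ α = w ^ α * (β / w) ^ α := by
    rw [← Real.mul_rpow hw.le (by positivity)]; field_simp
  rw [tsExponent, tsExponent, h1, h2, Real.mul_rpow hw.le (by positivity)]
  ring

lemma continuousOn_tsExponent {α β : ℝ} (hβ : 0 < β) :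
    ContinuousOn (tsExponent α β) (Set.Ici 0) := by
  unfold tsExponent
  refine continuousOn_const.mul (ContinuousOn.sub ?_ continuousOn_const)
  exact (continuousOn_const.add continuousOn_id).rpow_const fun x (hx : 0 ≤ x) ↦
    Or.inl (by dsimp; linarith)

/-! ### The rate and jump laws -/

lemma one_sub_add_mul_log_pos {α w : ℝ} (hα0 : 0 < α) (hw0 : 0 < w) (hw1 : w < 1) :
    0 < 1 - w ^ α + w ^ α * Real.log (w ^ α) := by
  have hx0 : 0 < w ^ α := Real.rpow_pos_of_pos hw0 _
  have hx1 : w ^ α < 1 := Real.rpow_lt_one hw0.le hw1 hα0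
  have h := Real.log_lt_sub_one_of_pos (inv_pos.2 hx0) (by simpa using hx1.ne)
  rw [Real.log_inv] at h
  have h2 := mul_lt_mul_of_pos_left h hx0
  rw [mul_sub, mul_inv_cancel₀ hx0.ne'] at h2
  linarith

lemma poissonIntensity_pos {α β c b w : ℝ} (hα0 : 0 < α) (hα1 : α < 1) (hβ : 0 < β) (hc : 0 < c)
    (hb : 0 < b) (hw0 : 0 < w) (hw1 : w < 1) : 0 < poissonIntensity α β c b w := by
  have := one_sub_add_mul_log_pos hα0 hw0 hw1
  have := Real.Gamma_pos_of_pos (sub_pos.2 hα1)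
  unfold poissonIntensity
  positivity

/-- The unnormalised density of the rate is `(v^α - 1) / v`; this is its total mass. -/
lemma integral_rpow_sub_one_div {α w : ℝ} (hα0 : 0 < α) (hw0 : 0 < w) (hw1 : w < 1) :
    ∫ v in (1 : ℝ)..(1 / w), (v ^ α - 1) / v =
      (1 - w ^ α + w ^ α * Real.log (w ^ α)) / (α * w ^ α) := by
  have h1w : 1 ≤ 1 / w := by rw [le_div_iff₀ hw0]; linarith
  have hpos : ∀ v ∈ Set.uIcc 1 (1 / w), 0 < v := fun v hv ↦ by
    rw [Set.uIcc_of_le h1w] at hv; linarith [hv.1]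
  have hd : ∀ v ∈ Set.uIcc 1 (1 / w),
      HasDerivAt (fun v : ℝ ↦ v ^ α / α - Real.log v) ((v ^ α - 1) / v) v := fun v hv ↦ by
    have hv0 := hpos v hv
    convert! ((Real.hasDerivAt_rpow_const (x := v) (p := α) (Or.inl hv0.ne')).div_const α).sub
      (Real.hasDerivAt_log hv0.ne') using 1
    rw [Real.rpow_sub_one hv0.ne']
    field_simp
  rw [intervalIntegral.integral_eq_sub_of_hasDerivAt hd]
  · have : 0 < w ^ α := Real.rpow_pos_of_pos hw0 _
    rw [one_div, Real.inv_rpow hw0.le, Real.log_inv, Real.log_rpow hw0]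
    simp only [Real.one_rpow, Real.log_one]
    field_simp
    ring
  · refine ContinuousOn.intervalIntegrable fun v hv ↦ ContinuousAt.continuousWithinAt ?_
    have hv0 := hpos v hv
    exact ((Real.continuousAt_rpow_const _ _ (Or.inl hv0.ne')).sub continuousAt_const).div
      continuousAt_id hv0.ne'

lemma rateDensity_nonneg {α w v : ℝ} (hα0 : 0 < α) (hw0 : 0 < w) (hw1 : w < 1) :
    0 ≤ rateDensity α w v := by
  unfold rateDensity
  split_ifs with h
  · have := one_sub_add_mul_log_pos hα0 hw0 hw1
    have h1 : 1 ≤ v ^ α := Real.one_le_rpow h.1 hα0.le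
    have h0 : 0 < v := by linarith [h.1]
    have h2 : 0 ≤ v ^ α - 1 := by linarith
    positivity
  · exact le_rfl

lemma measurable_rateDensity (α w : ℝ) : Measurable (rateDensity α w) := by
  unfold rateDensity
  refine Measurable.ite (by measurability) (by fun_prop) measurable_const

lemma rateDensity_eq_indicator (α w : ℝ) :
    rateDensity α w = (Set.Icc 1 (1 / w)).indicator fun v ↦
      α * w ^ α / (1 - w ^ α + w ^ α * Real.log (w ^ α)) * ((v ^ α - 1) / v) := by
  ext v
  simp [rateDensity, Set.indicator, Set.mem_Icc]

/-- Bochner integrals against the rate law, as integrals over `[1, 1/w]`. -/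
lemma integral_rateLaw {α w : ℝ} (hα0 : 0 < α) (hw0 : 0 < w) (hw1 : w < 1) (g : ℝ → ℝ) :
    ∫ v, g v ∂(rateLaw α w) = α * w ^ α / (1 - w ^ α + w ^ α * Real.log (w ^ α)) *
      ∫ v in (1 : ℝ)..(1 / w), (v ^ α - 1) / v * g v := by
  have h1w : 1 ≤ 1 / w := by rw [le_div_iff₀ hw0]; linarith
  rw [rateLaw, integral_withDensity_eq_integral_toReal_smul
    (measurable_rateDensity α w).ennreal_ofReal (by simp)]
  simp_rw [ENNReal.toReal_ofReal (rateDensity_nonneg hα0 hw0 hw1), smul_eq_mul,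
    rateDensity_eq_indicator]
  rw [intervalIntegral.integral_of_le h1w, ← integral_Icc_eq_integral_Ioc, ← integral_const_mul,
    ← integral_indicator measurableSet_Icc]
  congr 1 with v
  by_cases hv : v ∈ Set.Icc 1 (1 / w) <;> simp [Set.indicator, mul_assoc]

lemma integrable_rateDensity (α w : ℝ) :
    Integrable (rateDensity α w) := by
  rw [rateDensity_eq_indicator, integrable_indicator_iff measurableSet_Icc]
  refine ContinuousOn.integrableOn_Icc fun v hv ↦ ContinuousAt.continuousWithinAt ?_
  have hv0 : 0 < v := by linarith [hv.1]
  exact continuousAt_const.mul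
    (((Real.continuousAt_rpow_const _ _ (Or.inl hv0.ne')).sub continuousAt_const).div
      continuousAt_id hv0.ne')

lemma isProbabilityMeasure_rateLaw {α w : ℝ} (hα0 : 0 < α) (hw0 : 0 < w) (hw1 : w < 1) :
    IsProbabilityMeasure (rateLaw α w) := by
  have : IsFiniteMeasure (rateLaw α w) :=
    isFiniteMeasure_withDensity_ofReal (integrable_rateDensity α w).2
  have h := integral_rateLaw hα0 hw0 hw1 (fun _ ↦ 1)
  have hD := one_sub_add_mul_log_pos hα0 hw0 hw1
  have hx0 : 0 < w ^ α := Real.rpow_pos_of_pos hw0 _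
  simp only [mul_one] at h
  rw [integral_rpow_sub_one_div hα0 hw0 hw1, integral_const, smul_eq_mul, mul_one,
    div_mul_div_cancel₀ hD.ne', div_self (by positivity)] at h
  rw [isProbabilityMeasure_iff_real]
  exact h

lemma ae_rateLaw_mem_Icc (α w : ℝ) : ∀ᵐ v ∂(rateLaw α w), v ∈ Set.Icc 1 (1 / w) := by
  rw [rateLaw, ae_withDensity_iff (measurable_rateDensity α w).ennreal_ofReal]
  refine ae_of_all _ fun v hv ↦ ?_
  by_contra h
  exact hv (by rw [rateDensity_eq_indicator, Set.indicator_of_notMem h, ENNReal.ofReal_zero])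

lemma measurable_gammaPDF_uncurry (a β : ℝ) :
    Measurable fun p : ℝ × ℝ ↦ gammaPDF a (β * p.1) p.2 := by
  unfold gammaPDF gammaPDFReal
  refine (Measurable.ite (measurableSet_le measurable_const measurable_snd) ?_
    measurable_const).ennreal_ofReal
  fun_prop

lemma ofReal_jumpDensity {α β w x : ℝ} (hα0 : 0 < α) (hα1 : α < 1) (hβ : 0 < β) (hw0 : 0 < w)
    (hw1 : w < 1) (hx : x ≠ 0) :
    ENNReal.ofReal (jumpDensity α β w x) = ∫⁻ v, gammaPDF (1 - α) (β * v) x ∂(rateLaw α w) := by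
  have := isProbabilityMeasure_rateLaw hα0 hw0 hw1
  rcases lt_or_gt_of_ne hx with hx | hx
  · simp [gammaPDF_of_neg hx, jumpDensity, hx.not_gt]
  have h1w : 1 ≤ 1 / w := by rw [le_div_iff₀ hw0]; linarith
  have hnn : 0 ≤ᵐ[rateLaw α w] fun v ↦ gammaPDFReal (1 - α) (β * v) x := by
    filter_upwards [ae_rateLaw_mem_Icc α w] with v hv
    exact gammaPDFReal_nonneg (by linarith) (mul_pos hβ (by linarith [hv.1])) x
  have hmeas : Measurable fun v ↦ gammaPDFReal (1 - α) (β * v) x := by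
    unfold gammaPDFReal
    simp only [if_pos hx.le]
    fun_prop
  have hint : Integrable (fun v ↦ gammaPDFReal (1 - α) (β * v) x) (rateLaw α w) := by
    have hc : ContinuousOn (fun v ↦ gammaPDFReal (1 - α) (β * v) x) (Set.Icc 1 (1 / w)) := by
      intro v hv
      have : 0 < β * v := mul_pos hβ (by linarith [hv.1])
      unfold gammaPDFReal
      simp only [if_pos hx.le]
      refine ContinuousAt.continuousWithinAt ?_
      refine ContinuousAt.mul (ContinuousAt.mul (ContinuousAt.div_const ?_ _) ?_) ?_
      · exact ContinuousAt.rpow_const (by fun_prop) (Or.inl this.ne')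
      · exact continuousAt_const
      · fun_prop
    obtain ⟨C, hC⟩ := isCompact_Icc.exists_bound_of_continuousOn hc
    refine Integrable.of_bound hmeas.aestronglyMeasurable C ?_
    filter_upwards [ae_rateLaw_mem_Icc α w] with v hv using hC v hv
  have key : jumpDensity α β w x = ∫ v, gammaPDFReal (1 - α) (β * v) x ∂(rateLaw α w) := by
    rw [integral_rateLaw hα0 hw0 hw1, jumpDensity, if_pos hx]
    congr 1
    refine intervalIntegral.integral_congr fun v _ ↦ ?_
    simp only [gammaPDFReal, if_pos hx.le]
    rw [show (1 - α - 1 : ℝ) = -α by ring, show -β * v * x = -(β * v * x) by ring]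
    ring
  rw [key, ofReal_integral_eq_lintegral_ofReal hint hnn]
  rfl

/-- The jump law is a mixture of gamma laws: Tonelli's theorem for its density. -/
lemma lintegral_jumpLaw {α β w : ℝ} (hα0 : 0 < α) (hα1 : α < 1) (hβ : 0 < β) (hw0 : 0 < w)
    (hw1 : w < 1) {f : ℝ → ℝ≥0∞} (hf : Measurable f) :
    ∫⁻ x, f x ∂(jumpLaw α β w) =
      ∫⁻ v, ∫⁻ x, f x ∂(gammaMeasure (1 - α) (β * v)) ∂(rateLaw α w) := by
  have := isProbabilityMeasure_rateLaw hα0 hw0 hw1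
  have hae : (fun x ↦ ENNReal.ofReal (jumpDensity α β w x)) =ᵐ[volume]
      fun x ↦ ∫⁻ v, gammaPDF (1 - α) (β * v) x ∂(rateLaw α w) := by
    filter_upwards [Measure.ae_ne volume 0] with x hx using
      ofReal_jumpDensity hα0 hα1 hβ hw0 hw1 hx
  have hm := measurable_gammaPDF_uncurry (1 - α) β
  have hm' : Measurable fun p : ℝ × ℝ ↦ gammaPDF (1 - α) (β * p.2) p.1 := hm.comp measurable_swap
  rw [jumpLaw, withDensity_congr_ae hae,
    lintegral_withDensity_eq_lintegral_mul _ hm'.lintegral_prod_right' hf]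
  simp only [Pi.mul_apply]
  have h1 : ∀ x, (∫⁻ v, gammaPDF (1 - α) (β * v) x ∂(rateLaw α w)) * f x =
      ∫⁻ v, gammaPDF (1 - α) (β * v) x * f x ∂(rateLaw α w) := fun x ↦
    (lintegral_mul_const _ (hm'.comp measurable_prodMk_left)).symm
  simp_rw [h1]
  rw [lintegral_lintegral_swap]
  · refine lintegral_congr fun v ↦ ?_
    have hv : Measurable (gammaPDF (1 - α) (β * v)) :=
      (measurable_gammaPDFReal _ _).ennreal_ofReal
    rw [gammaMeasure, lintegral_withDensity_eq_lintegral_mul _ hv hf]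
    rfl
  · exact (hm'.mul (hf.comp measurable_fst)).aemeasurable

lemma jumpLaw_apply {α β w : ℝ} (hα0 : 0 < α) (hα1 : α < 1) (hβ : 0 < β) (hw0 : 0 < w)
    (hw1 : w < 1) {s : Set ℝ} (hs : MeasurableSet s) :
    jumpLaw α β w s = ∫⁻ v, gammaMeasure (1 - α) (β * v) s ∂(rateLaw α w) := by
  have h := lintegral_jumpLaw hα0 hα1 hβ hw0 hw1 (f := s.indicator 1)
    (measurable_one.indicator hs)
  simpa only [lintegral_indicator_one hs] using h

lemma isProbabilityMeasure_jumpLaw {α β w : ℝ} (hα0 : 0 < α) (hα1 : α < 1) (hβ : 0 < β)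
    (hw0 : 0 < w) (hw1 : w < 1) : IsProbabilityMeasure (jumpLaw α β w) := by
  have := isProbabilityMeasure_rateLaw hα0 hw0 hw1
  refine ⟨?_⟩
  rw [jumpLaw_apply hα0 hα1 hβ hw0 hw1 MeasurableSet.univ]
  rw [lintegral_congr_ae (g := fun _ ↦ 1), lintegral_one, measure_univ]
  filter_upwards [ae_rateLaw_mem_Icc α w] with v hv
  have := isProbabilityMeasure_gammaMeasure (a := 1 - α) (r := β * v) (by linarith)
    (mul_pos hβ (by linarith [hv.1]))
  exact measure_univ

lemma ae_jumpLaw_nonneg (α β w : ℝ) : ∀ᵐ x ∂(jumpLaw α β w), 0 ≤ x := by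
  have hz : jumpLaw α β w (Set.Iio 0) = 0 := by
    rw [jumpLaw, withDensity_apply _ measurableSet_Iio]
    refine (setLIntegral_congr_fun measurableSet_Iio fun x (hx : x < 0) ↦ ?_).trans
      lintegral_zero
    simp [jumpDensity, hx.not_gt]
  rw [ae_iff]
  simpa [Set.Iio] using hz

lemma lintegral_exp_gammaMeasure {a κ r : ℝ} (ha : 0 < a) (hκ : 0 < κ) (hr : 0 ≤ r) :
    ∫⁻ x, ENNReal.ofReal (Real.exp (-r * x)) ∂(gammaMeasure a κ) =
      ENNReal.ofReal (κ ^ a * (κ + r) ^ (-a)) := by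
  have hm : Measurable (gammaPDF a κ) := (measurable_gammaPDFReal a κ).ennreal_ofReal
  have hκr : 0 < κ + r := by linarith
  have hm' : Measurable (gammaPDF a (κ + r)) := (measurable_gammaPDFReal a _).ennreal_ofReal
  rw [gammaMeasure, lintegral_withDensity_eq_lintegral_mul _ hm (by fun_prop)]
  -- tilting the gamma density by `exp (-r x)` gives a multiple of the density of rate `κ + r`
  have : ∀ x, (gammaPDF a κ * fun x ↦ ENNReal.ofReal (Real.exp (-r * x))) x =
      ENNReal.ofReal (κ ^ a * (κ + r) ^ (-a)) * gammaPDF a (κ + r) x := fun x ↦ by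
    simp only [Pi.mul_apply, gammaPDF]
    rw [← ENNReal.ofReal_mul (gammaPDFReal_nonneg ha hκ x), ← ENNReal.ofReal_mul (by positivity)]
    congr 1
    unfold gammaPDFReal
    split_ifs
    · rw [Real.rpow_neg hκr.le, show -((κ + r) * x) = -(κ * x) + -r * x by ring, Real.exp_add]
      field_simp
    · simp
  simp_rw [this]
  rw [lintegral_const_mul _ hm', lintegral_gammaPDF_eq_one ha hκr, mul_one]

/-- The Laplace transform of the jump law. -/
lemma integral_exp_jumpLaw {α β w r : ℝ} (hα0 : 0 < α) (hα1 : α < 1) (hβ : 0 < β) (hw0 : 0 < w)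
    (hw1 : w < 1) (hr : 0 ≤ r) :
    ∫ x, Real.exp (-r * x) ∂(jumpLaw α β w) =
      ∫ v, (β * v) ^ (1 - α) * (β * v + r) ^ (α - 1) ∂(rateLaw α w) := by
  have h1 : ∀ᵐ v ∂(rateLaw α w), 0 ≤ (β * v) ^ (1 - α) * (β * v + r) ^ (α - 1) := by
    filter_upwards [ae_rateLaw_mem_Icc α w] with v hv
    have : 0 < β * v := mul_pos hβ (by linarith [hv.1])
    positivity
  rw [integral_eq_lintegral_of_nonneg_ae (ae_of_all _ fun x ↦ (Real.exp_pos _).le) (by fun_prop),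
    integral_eq_lintegral_of_nonneg_ae h1 (by fun_prop),
    lintegral_jumpLaw hα0 hα1 hβ hw0 hw1 (by fun_prop)]
  congr 1
  refine lintegral_congr_ae ?_
  filter_upwards [ae_rateLaw_mem_Icc α w] with v hv
  rw [lintegral_exp_gammaMeasure (by linarith) (mul_pos hβ (by linarith [hv.1])) hr, neg_sub]

/-! ### The identity between Laplace exponents -/

/-- The Laplace exponent of the compound Poisson law, as an integral over the rate. -/
lemma poissonIntensity_mul_one_sub {α β c b w r : ℝ} (hα0 : 0 < α) (hα1 : α < 1) (hβ : 0 < β)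
    (hb : 0 < b) (hw0 : 0 < w) (hw1 : w < 1) (hr : 0 ≤ r) :
    poissonIntensity α β c b w * (1 - ∫ x, Real.exp (-r * x) ∂(jumpLaw α β w)) =
      c * (β ^ α * Real.Gamma (1 - α) / (2 * b * α) * ∫ v in (1 : ℝ)..(1 / w),
        (v ^ α - 1) / v * (1 - (β * v) ^ (1 - α) * (β * v + r) ^ (α - 1))) := by
  have := isProbabilityMeasure_rateLaw hα0 hw0 hw1
  have hint : Integrable (fun v ↦ (β * v) ^ (1 - α) * (β * v + r) ^ (α - 1)) (rateLaw α w) := by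
    refine Integrable.of_bound (by fun_prop) 1 ?_
    filter_upwards [ae_rateLaw_mem_Icc α w] with v hv
    have hv0 : 0 < β * v := mul_pos hβ (by linarith [hv.1])
    have hvr : 0 < β * v + r := by linarith
    rw [Real.norm_of_nonneg (by positivity), ← neg_sub 1 α, Real.rpow_neg hvr.le,
      ← div_eq_mul_inv, div_le_one (by positivity)]
    exact Real.rpow_le_rpow hv0.le (by linarith) (by linarith)
  have h1 : 1 - ∫ x, Real.exp (-r * x) ∂(jumpLaw α β w) =
      ∫ v, (1 - (β * v) ^ (1 - α) * (β * v + r) ^ (α - 1)) ∂(rateLaw α w) := by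
    rw [integral_exp_jumpLaw hα0 hα1 hβ hw0 hw1 hr, integral_sub (integrable_const _) hint]
    simp
  rw [h1, integral_rateLaw hα0 hw0 hw1, poissonIntensity]
  have := one_sub_add_mul_log_pos hα0 hw0 hw1
  have hx0 : 0 < w ^ α := Real.rpow_pos_of_pos hw0 _
  generalize (∫ v in (1 : ℝ)..(1 / w), (v ^ α - 1) / v *
    (1 - (β * v) ^ (1 - α) * (β * v + r) ^ (α - 1))) = I
  field_simp

/-- The substitution `z = e^{2bs}` reduces the time integral of the exponent to the fundamental
theorem of calculus: this is a primitive of `s ↦ tsExponent α β (r e^{-2bs})`. -/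
lemma hasDerivAt_tsExponent_primitive {α β b r : ℝ} (hα0 : 0 < α) (hβ : 0 < β)
    (hb : 0 < b) (hr : 0 ≤ r) {s : ℝ} (hs : 0 ≤ s) :
    HasDerivAt (fun s ↦
      (1 - Real.exp (2 * b * s) ^ (-α)) / (2 * α * b) * tsExponent α (β * Real.exp (2 * b * s)) r +
      β ^ α * Real.Gamma (1 - α) / (2 * b * α) * ∫ v in (1 : ℝ)..(Real.exp (2 * b * s)),
        (v ^ α - 1) / v * (1 - (β * v) ^ (1 - α) * (β * v + r) ^ (α - 1)))
      (tsExponent α β (r * Real.exp (-2 * b * s))) s := by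
  set z := Real.exp (2 * b * s) with hz
  have hz0 : 0 < z := Real.exp_pos _
  have hz1 : 1 ≤ z := Real.one_le_exp (by positivity)
  have hinv : Real.exp (-2 * b * s) = z⁻¹ := by rw [hz, ← Real.exp_neg]; ring_nf
  have hβz : 0 < β * z := mul_pos hβ hz0
  have hβzr : 0 < β * z + r := by linarith
  set G : ℝ → ℝ := fun v ↦ (v ^ α - 1) / v * (1 - (β * v) ^ (1 - α) * (β * v + r) ^ (α - 1))
    with hG
  have hGc : ∀ v, 0 < v → ContinuousAt G v := fun v hv ↦ by
    have h1 : 0 < β * v := mul_pos hβ hv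
    refine ContinuousAt.mul (((Real.continuousAt_rpow_const _ _ (Or.inl hv.ne')).sub
      continuousAt_const).div continuousAt_id hv.ne') (continuousAt_const.sub ?_)
    exact (ContinuousAt.rpow_const (by fun_prop) (Or.inl h1.ne')).mul
      (ContinuousAt.rpow_const (by fun_prop) (Or.inl (by linarith)))
  have dz : HasDerivAt (fun s ↦ Real.exp (2 * b * s)) (z * (2 * b)) s := by
    simpa using ((hasDerivAt_id s).const_mul (2 * b)).exp
  have dG : HasDerivAt (fun y ↦ ∫ v in (1 : ℝ)..y, G v) (G z) z := by
    refine intervalIntegral.integral_hasDerivAt_right ?_ ?_ (hGc z hz0)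
    · refine ContinuousOn.intervalIntegrable fun v hv ↦ (hGc v ?_).continuousWithinAt
      rw [Set.uIcc_of_le hz1] at hv
      linarith [hv.1]
    · have : Measurable G := by fun_prop
      exact this.stronglyMeasurable.stronglyMeasurableAtFilter
  have d1 : HasDerivAt (fun y : ℝ ↦ y ^ (-α)) (-α * z ^ (-α - 1)) z :=
    Real.hasDerivAt_rpow_const (Or.inl hz0.ne')
  have d2 : HasDerivAt (fun y : ℝ ↦ (β * y) ^ α) (β * α * (β * z) ^ (α - 1)) z := by
    have := ((hasDerivAt_id z).const_mul β).rpow_const (p := α) (Or.inl hβz.ne')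
    simpa using this
  have d3 : HasDerivAt (fun y : ℝ ↦ (β * y + r) ^ α) (β * α * (β * z + r) ^ (α - 1)) z := by
    have := (((hasDerivAt_id z).const_mul β).add_const r).rpow_const (p := α) (Or.inl hβzr.ne')
    simpa using this
  have d4 := (((d1.const_sub 1).div_const (2 * α * b)).mul
    ((d3.sub d2).const_mul (Real.Gamma (1 - α) / α))).add
    (dG.const_mul (β ^ α * Real.Gamma (1 - α) / (2 * b * α)))
  convert! d4.comp s dz using 1
  have e1 : (β * z + r) ^ α = (β * z + r) ^ (α - 1) * (β * z + r) := by
    rw [← Real.rpow_add_one hβzr.ne']; ring_nf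
  have e2 : (β * z) ^ α = (β * z) ^ (α - 1) * (β * z) := by
    rw [← Real.rpow_add_one hβz.ne']; ring_nf
  have e3 : (β * z) ^ (1 - α) = ((β * z) ^ (α - 1))⁻¹ := by
    rw [← Real.rpow_neg hβz.le]; ring_nf
  have e4 : β ^ α = (β * z) ^ (α - 1) * (β * z) / z ^ α := by
    rw [← e2, Real.mul_rpow hβ.le hz0.le]
    field_simp
  have e5 : (β + r * z⁻¹) ^ α = (β * z + r) ^ (α - 1) * (β * z + r) / z ^ α := by
    rw [← e1, ← Real.div_rpow hβzr.le hz0.le]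
    congr 1
    field_simp
  have e6 : z ^ (-α - 1) = (z ^ α)⁻¹ / z := by
    rw [Real.rpow_sub_one hz0.ne', Real.rpow_neg hz0.le]
  have hA : 0 < (β * z + r) ^ (α - 1) := Real.rpow_pos_of_pos hβzr _
  have hB : 0 < (β * z) ^ (α - 1) := Real.rpow_pos_of_pos hβz _
  have hZ : 0 < z ^ α := Real.rpow_pos_of_pos hz0 _
  simp only [tsExponent, hinv, hG, Pi.sub_apply, e5, e6, e3, Real.rpow_neg hz0.le]
  rw [e1, e2, e4]
  generalize (β * z + r) ^ (α - 1) = A at *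
  generalize (β * z) ^ (α - 1) = B at *
  generalize z ^ α = Z at *
  clear_value z
  field_simp
  ring

/-- The exponent of the Ornstein-Uhlenbeck increment splits into the exponents of a tempered
stable law with rate `β / w` and of a compound Poisson law. -/
lemma integral_tsExponent_eq_add {α β c b r t w : ℝ} (hα0 : 0 < α) (hα1 : α < 1) (hβ : 0 < β)
    (hb : 0 < b) (hr : 0 ≤ r) (ht : 0 < t) (hw : w = Real.exp (-2 * b * t)) :
    c * ∫ s in (0 : ℝ)..t, tsExponent α β (r * Real.exp (-2 * b * s)) =
      c * ((1 - w ^ α) / (2 * α * b)) * tsExponent α (β / w) r +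
        poissonIntensity α β c b w * (1 - ∫ x, Real.exp (-r * x) ∂(jumpLaw α β w)) := by
  have hw0 : 0 < w := hw ▸ Real.exp_pos _
  have hw1 : w < 1 := by rw [hw, Real.exp_lt_one_iff]; nlinarith [mul_pos hb ht]
  have hwi : Real.exp (2 * b * t) = 1 / w := by
    rw [hw, one_div, ← Real.exp_neg]; ring_nf
  have hcont : ContinuousOn (fun s ↦ tsExponent α β (r * Real.exp (-2 * b * s)))
      (Set.uIcc 0 t) :=
    (continuousOn_tsExponent hβ).comp (by fun_prop) fun s _ ↦
      mul_nonneg hr (Real.exp_pos _).le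
  rw [intervalIntegral.integral_eq_sub_of_hasDerivAt (fun s hs ↦
    hasDerivAt_tsExponent_primitive hα0 hβ hb hr (by
      rw [Set.uIcc_of_le ht.le] at hs; exact hs.1)) hcont.intervalIntegrable,
    poissonIntensity_mul_one_sub hα0 hα1 hβ hb hw0 hw1 hr, hwi]
  simp only [mul_zero, Real.exp_zero, Real.one_rpow, sub_self, zero_div, zero_mul,
    intervalIntegral.integral_same, add_zero, sub_zero]
  rw [one_div, Real.inv_rpow hw0.le, Real.rpow_neg hw0.le, inv_inv, ← div_eq_mul_inv β w]
  ring

/-! ### Subordinated Brownian motion -/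

lemma ProbabilityTheory.IsPreBrownianReal.integral_cexp_sub {Ω : Type*} [MeasurableSpace Ω]
    {P : Measure Ω}
    {W : ℝ≥0 → Ω → ℝ} (hW : IsPreBrownianReal W P) {s t : ℝ≥0} (hst : s ≤ t) (u : ℝ) :
    ∫ ω, Complex.exp (((u * (W t ω - W s ω) : ℝ) : ℂ) * Complex.I) ∂P =
      ((Real.exp (-(u ^ 2 / 2 * (t - s))) : ℝ) : ℂ) := by
  have hl := hW.hasLaw_sub t s
  have h := charFun_gaussianReal (μ := 0) (v := nndist t.1 s.1) u
  rw [← hl.map_eq, charFun_apply_real, integral_map hl.aemeasurable (by fun_prop)] at h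
  have hd : ((nndist t.1 s.1 : ℝ≥0) : ℝ) = t - s := by
    rw [coe_nndist, Real.dist_eq]
    exact abs_of_nonneg (sub_nonneg.2 hst)
  have hd' : (((nndist t.1 s.1 : ℝ≥0) : ℝ) : ℂ) = (t : ℝ) - (s : ℝ) := by
    rw [hd]; push_cast; rfl
  rw [hd'] at h
  convert! h using 1
  · simp
  · push_cast; ring_nf

/-- The joint characteristic function of the increments of a Brownian motion. -/
lemma ProbabilityTheory.IsPreBrownianReal.integral_cexp_sum {Ω : Type*} [MeasurableSpace Ω]
    {P : Measure Ω}
    {W : ℝ≥0 → Ω → ℝ} (hW : IsPreBrownianReal W P) {n : ℕ} {d : Fin (n + 1) → ℝ≥0}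
    (hd : Monotone d) (u : Fin n → ℝ) :
    ∫ ω, Complex.exp (((∑ j, u j * (W (d j.succ) ω - W (d j.castSucc) ω) : ℝ) : ℂ) * Complex.I) ∂P =
      ((Real.exp (-∑ j, u j ^ 2 / 2 * (d j.succ - d j.castSucc)) : ℝ) : ℂ) := by
  have h := (hW.hasIndepIncrements n d hd).integral_fun_prod_comp (𝕜 := ℂ)
    (f := fun j x ↦ Complex.exp (((u j * x : ℝ) : ℂ) * Complex.I))
    (fun j ↦ (hW.aemeasurable _).sub (hW.aemeasurable _)) (fun j ↦ by fun_prop)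
  rw [Finset.prod_congr rfl fun j _ ↦
    hW.integral_cexp_sub (hd (Fin.castSucc_le_succ j)) (u j)] at h
  rw [← Finset.sum_neg_distrib, Real.exp_sum]
  push_cast at h ⊢
  rw [← h]
  simp_rw [Finset.sum_mul, Complex.exp_sum]

/-- `x` rounded down to a multiple of `1 / (m + 1)`. -/
noncomputable def gridFloor (m : ℕ) (x : ℝ≥0) : ℝ≥0 := (⌊(x : ℝ) * (m + 1)⌋₊ : ℝ≥0) / (m + 1)

lemma gridFloor_mono (m : ℕ) : Monotone (gridFloor m) := fun x y hxy ↦ by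
  unfold gridFloor
  gcongr

lemma tendsto_gridFloor (x : ℝ≥0) : Tendsto (fun m ↦ gridFloor m x) atTop (𝓝 x) := by
  rw [← NNReal.tendsto_coe]
  have h := (tendsto_nat_floor_mul_div_atTop (R := ℝ) x.2).comp
    (tendsto_atTop_add_const_right atTop 1 (tendsto_natCast_atTop_atTop (R := ℝ)))
  refine h.congr fun m ↦ ?_
  simp [gridFloor]

lemma measurable_gridFloor (m : ℕ) : Measurable (gridFloor m) := by
  unfold gridFloor
  have h : Measurable fun x : ℝ≥0 ↦ ⌊(x : ℝ) * (m + 1)⌋₊ := Nat.measurable_floor.comp (by fun_prop)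
  exact (measurable_from_nat.comp h (f := fun x : ℝ≥0 ↦ ⌊(x : ℝ) * (m + 1)⌋₊)
    (g := fun k : ℕ ↦ (k : ℝ≥0) / (m + 1)))

/-- Evaluating a measurable process at a random time on a grid is measurable, since the grid is
countable. -/
lemma measurable_comp_gridFloor {Ω : Type*} [MeasurableSpace Ω] {W : ℝ≥0 → Ω → ℝ}
    (hW : ∀ t, Measurable (W t)) {T : Ω → ℝ≥0} (hT : Measurable T) (m : ℕ) :
    Measurable fun ω ↦ W (gridFloor m (T ω)) ω := by
  have h1 : Measurable fun p : ℕ × Ω ↦ W ((p.1 : ℝ≥0) / (m + 1)) p.2 :=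
    measurable_from_prod_countable_right fun k ↦ hW ((k : ℝ≥0) / (m + 1))
  have h2 : Measurable fun ω ↦ ⌊(T ω : ℝ) * (m + 1)⌋₊ := Nat.measurable_floor.comp (by fun_prop)
  exact h1.comp (h2.prodMk measurable_id)

lemma aemeasurable_comp_time {Ω : Type*} [MeasurableSpace Ω] {P : Measure Ω} {W : ℝ≥0 → Ω → ℝ}
    (hW : ∀ t, Measurable (W t)) (hB : IsBrownianReal W P) {T : Ω → ℝ≥0} (hT : Measurable T) :
    AEMeasurable (fun ω ↦ W (T ω) ω) P := by
  refine aemeasurable_of_tendsto_metrizable_ae atTop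
    (fun m ↦ (measurable_comp_gridFloor hW hT m).aemeasurable) ?_
  filter_upwards [hB.cont] with ω hω
  exact (hω.tendsto _).comp (tendsto_gridFloor _)

/-- The joint characteristic function of the increments of a Brownian motion at independent
random times on a grid, by conditioning on the (countably many) values of the times. -/
lemma integral_cexp_sum_gridFloor {Ω : Type*} [MeasurableSpace Ω] {P : Measure Ω}
    [IsProbabilityMeasure P] {W : ℝ≥0 → Ω → ℝ} (hW : ∀ t, Measurable (W t))
    (hB : IsPreBrownianReal W P) {n : ℕ} {T : Fin (n + 1) → Ω → ℝ≥0} (hT : ∀ j, Measurable (T j))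
    (hmono : ∀ᵐ ω ∂P, Monotone fun j ↦ T j ω)
    (hind : IndepFun (fun ω j ↦ T j ω) (fun ω t ↦ W t ω) P) (u : Fin n → ℝ) (m : ℕ) :
    ∫ ω, Complex.exp (((∑ j, u j * (W (gridFloor m (T j.succ ω)) ω -
        W (gridFloor m (T j.castSucc ω)) ω) : ℝ) : ℂ) * Complex.I) ∂P =
      ∫ ω, ((Real.exp (-∑ j, u j ^ 2 / 2 *
        (gridFloor m (T j.succ ω) - gridFloor m (T j.castSucc ω))) : ℝ) : ℂ) ∂P := by
  set k : Ω → Fin (n + 1) → ℕ := fun ω j ↦ ⌊(T j ω : ℝ) * (m + 1)⌋₊ with hk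
  set g : ℕ → ℝ≥0 := fun i ↦ (i : ℝ≥0) / (m + 1) with hg
  have hkm : Measurable k :=
    measurable_pi_lambda _ fun j ↦ Nat.measurable_floor.comp (by fun_prop)
  have hWm : Measurable fun ω t ↦ W t ω := measurable_pi_lambda _ hW
  have hkW : IndepFun k (fun ω t ↦ W t ω) P := by
    have hφ : Measurable fun (x : Fin (n + 1) → ℝ≥0) (j : Fin (n + 1)) ↦
        ⌊(x j : ℝ) * (m + 1)⌋₊ :=
      measurable_pi_lambda _ fun j ↦ Nat.measurable_floor.comp (by fun_prop)
    exact hind.comp hφ measurable_id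
  set G : (Fin (n + 1) → ℕ) × (ℝ≥0 → ℝ) → ℂ := fun p ↦ Complex.exp
    (((∑ j : Fin n, u j * (p.2 (g (p.1 j.succ)) - p.2 (g (p.1 j.castSucc))) : ℝ) : ℂ) *
      Complex.I) with hG
  have hGm : Measurable G := by
    refine measurable_from_prod_countable_right fun x ↦ ?_
    simp only [hG]
    fun_prop
  have hGb : ∀ p, ‖G p‖ ≤ 1 := fun p ↦ (Complex.norm_exp_ofReal_mul_I _).le
  have hprod := (indepFun_iff_map_prod_eq_prod_map_map hkm.aemeasurable hWm.aemeasurable).1 hkW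
  have : IsProbabilityMeasure (P.map k) := Measure.isProbabilityMeasure_map hkm.aemeasurable
  have : IsProbabilityMeasure (P.map fun ω t ↦ W t ω) :=
    Measure.isProbabilityMeasure_map hWm.aemeasurable
  have hinner : ∀ᵐ ω ∂P, ∫ p, G (k ω, p) ∂(P.map fun ω t ↦ W t ω) =
      ((Real.exp (-∑ j : Fin n, u j ^ 2 / 2 *
        (gridFloor m (T j.succ ω) - gridFloor m (T j.castSucc ω))) : ℝ) : ℂ) := by
    filter_upwards [hmono] with ω hω
    have hGω : Measurable fun p ↦ G (k ω, p) := hGm.comp measurable_prodMk_left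
    rw [integral_map hWm.aemeasurable hGω.aestronglyMeasurable]
    exact hB.integral_cexp_sum (d := fun j ↦ gridFloor m (T j ω))
      ((gridFloor_mono m).comp hω) u
  calc _ = ∫ ω, G (k ω, fun t ↦ W t ω) ∂P := rfl
    _ = ∫ p, G p ∂((P.map k).prod (P.map fun ω t ↦ W t ω)) := by
      rw [← hprod, integral_map (hkm.prodMk hWm).aemeasurable hGm.aestronglyMeasurable]
    _ = ∫ x, ∫ p, G (x, p) ∂(P.map fun ω t ↦ W t ω) ∂(P.map k) :=
      integral_prod _ (Integrable.of_bound hGm.aestronglyMeasurable 1 (ae_of_all _ hGb))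
    _ = ∫ ω, ∫ p, G (k ω, p) ∂(P.map fun ω t ↦ W t ω) ∂P := by
      rw [integral_map hkm.aemeasurable (Measurable.of_discrete).aestronglyMeasurable]
    _ = _ := integral_congr_ae hinner

/-- The joint characteristic function of the increments of a Brownian motion at independent
ordered random times: pass to the limit in the grid, using continuity of the paths. -/
lemma integral_cexp_sum_comp_time {Ω : Type*} [MeasurableSpace Ω] {P : Measure Ω}
    [IsProbabilityMeasure P] {W : ℝ≥0 → Ω → ℝ} (hW : ∀ t, Measurable (W t))
    (hB : IsBrownianReal W P) {n : ℕ} {T : Fin (n + 1) → Ω → ℝ≥0} (hT : ∀ j, Measurable (T j))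
    (hmono : ∀ᵐ ω ∂P, Monotone fun j ↦ T j ω)
    (hind : IndepFun (fun ω j ↦ T j ω) (fun ω t ↦ W t ω) P) (u : Fin n → ℝ) :
    ∫ ω, Complex.exp (((∑ j, u j * (W (T j.succ ω) ω - W (T j.castSucc ω) ω) : ℝ) : ℂ) *
        Complex.I) ∂P =
      ∫ ω, ((Real.exp (-∑ j, u j ^ 2 / 2 * (T j.succ ω - T j.castSucc ω)) : ℝ) : ℂ) ∂P := by
  have hWm := fun j m ↦ measurable_comp_gridFloor hW (hT j) m
  have hTm : ∀ j m, Measurable fun ω ↦ (gridFloor m (T j ω) : ℝ) := fun j m ↦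
    ((measurable_gridFloor m).comp (hT j)).coe_nnreal_real
  have lim1 : Tendsto (fun m : ℕ ↦ ∫ ω, Complex.exp (((∑ j, u j *
      (W (gridFloor m (T j.succ ω)) ω - W (gridFloor m (T j.castSucc ω)) ω) : ℝ) : ℂ) *
        Complex.I) ∂P) atTop
      (𝓝 (∫ ω, Complex.exp (((∑ j, u j * (W (T j.succ ω) ω - W (T j.castSucc ω) ω) : ℝ) : ℂ) *
        Complex.I) ∂P)) := by
    refine tendsto_integral_of_dominated_convergence (fun _ ↦ 1) (fun m ↦ ?_)
      (integrable_const _) (fun m ↦ ae_of_all _ fun ω ↦ (Complex.norm_exp_ofReal_mul_I _).le) ?_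
    · exact (Complex.measurable_exp.comp ((Complex.measurable_ofReal.comp
        (Finset.measurable_sum _ fun j _ ↦
          ((hWm _ m).sub (hWm _ m)).const_mul _)).mul_const _)).aestronglyMeasurable
    · filter_upwards [hB.cont] with ω hω
      have hl : ∀ j, Tendsto (fun m ↦ W (gridFloor m (T j ω)) ω) atTop (𝓝 (W (T j ω) ω)) :=
        fun j ↦ (hω.tendsto _).comp (tendsto_gridFloor _)
      refine (Complex.continuous_exp.tendsto _).comp (Tendsto.mul_const _ ?_)
      refine (Complex.continuous_ofReal.tendsto _).comp (tendsto_finsetSum _ fun j _ ↦ ?_)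
      exact ((hl _).sub (hl _)).const_mul _
  have lim2 : Tendsto (fun m : ℕ ↦ ∫ ω, ((Real.exp (-∑ j, u j ^ 2 / 2 *
        (gridFloor m (T j.succ ω) - gridFloor m (T j.castSucc ω))) : ℝ) : ℂ) ∂P) atTop
      (𝓝 (∫ ω, ((Real.exp (-∑ j, u j ^ 2 / 2 * (T j.succ ω - T j.castSucc ω)) : ℝ) : ℂ) ∂P)) := by
    refine tendsto_integral_of_dominated_convergence (fun _ ↦ 1) (fun m ↦ ?_)
      (integrable_const _) (fun m ↦ ?_) (ae_of_all _ fun ω ↦ ?_)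
    · exact Measurable.aestronglyMeasurable (by fun_prop)
    · filter_upwards [hmono] with ω hω
      rw [Complex.norm_real, Real.norm_of_nonneg (Real.exp_pos _).le, Real.exp_le_one_iff,
        neg_nonpos]
      refine Finset.sum_nonneg fun j _ ↦ mul_nonneg (by positivity) (sub_nonneg.2 ?_)
      exact gridFloor_mono m (hω (Fin.castSucc_le_succ j))
    · have hl : ∀ j, Tendsto (fun m ↦ (gridFloor m (T j ω) : ℝ)) atTop (𝓝 (T j ω)) :=
        fun j ↦ NNReal.tendsto_coe.2 (tendsto_gridFloor _)
      refine (Complex.continuous_ofReal.tendsto _).comp ((Real.continuous_exp.tendsto _).comp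
        (tendsto_finsetSum _ fun j _ ↦ ?_).neg)
      exact ((hl _).sub (hl _)).const_mul _
  refine tendsto_nhds_unique lim1 (lim2.congr fun m ↦ ?_)
  exact (integral_cexp_sum_gridFloor hW hB.toIsPreBrownianReal hT hmono hind u m).symm

/-! ### Tempered stable subordinators and normal tempered stable processes -/

lemma IsTSLaw.integral_exp {α β c r : ℝ} {μ : Measure ℝ} (h : IsTSLaw α β c μ) (hα0 : 0 < α)
    (hα1 : α < 1) (hβ : 0 < β) (hr : 0 ≤ r) :
    ∫ x, Real.exp (-r * x) ∂μ = Real.exp (-(c * tsExponent α β r)) := by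
  rw [h.laplace r hr, integral_one_sub_exp_mul_tsLevyDensity hα0 hα1 hβ hr]

section Subordinator

variable {Ω : Type*} [MeasurableSpace Ω] {P : Measure Ω} {α β c : ℝ} {L : ℝ≥0 → Ω → ℝ≥0}

lemma IsTSSubordinator.measurable (hL : IsTSSubordinator α β c L P) (t : ℝ≥0) :
    Measurable (L t) :=
  measurable_coe_nnreal_real_iff.1 (hL.isLevyProcess.measurable t)

lemma IsTSSubordinator.integral_exp_sub (hL : IsTSSubordinator α β c L P) (hα0 : 0 < α)
    (hα1 : α < 1) (hβ : 0 < β) {s t : ℝ≥0} (hst : s ≤ t) {r : ℝ} (hr : 0 ≤ r) :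
    ∫ ω, Real.exp (-r * ((L t ω : ℝ) - L s ω)) ∂P =
      Real.exp (-(c * (t - s) * tsExponent α β r)) := by
  have hid := hL.isLevyProcess.stationary_increments s (t - s)
  rw [add_tsub_cancel_of_le hst] at hid
  have hm := (hL.isLevyProcess.measurable (t - s)).aemeasurable (μ := P)
  have h := (hL.law (t - s)).integral_exp hα0 hα1 hβ hr
  rw [integral_map hm (by fun_prop), NNReal.coe_sub hst] at h
  rw [← h]
  exact (hid.comp (u := fun x ↦ Real.exp (-r * x)) (by fun_prop)).integral_eq

/-- The joint Laplace transform of the increments of a tempered stable subordinator. -/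
lemma IsTSSubordinator.integral_exp_sum (hL : IsTSSubordinator α β c L P) (hα0 : 0 < α)
    (hα1 : α < 1) (hβ : 0 < β) {n : ℕ} {τ : Fin (n + 1) → ℝ≥0} (hτ : Monotone τ)
    {r : Fin n → ℝ} (hr : ∀ j, 0 ≤ r j) :
    ∫ ω, Real.exp (-∑ j, r j * ((L (τ j.succ) ω : ℝ) - L (τ j.castSucc) ω)) ∂P =
      Real.exp (-∑ j, c * (τ j.succ - τ j.castSucc) * tsExponent α β (r j)) := by
  have hm := hL.isLevyProcess.measurable
  have h := (hL.isLevyProcess.indep_increments n τ hτ).integral_fun_prod_comp (𝕜 := ℝ)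
    (f := fun j x ↦ Real.exp (-r j * x))
    (fun j ↦ ((hm _).sub (hm _)).aemeasurable) (fun j ↦ by fun_prop)
  rw [Finset.prod_congr rfl fun j _ ↦
    hL.integral_exp_sub hα0 hα1 hβ (hτ (Fin.castSucc_le_succ j)) (hr j)] at h
  simp_rw [← Real.exp_sum, Finset.sum_neg_distrib, neg_mul, Finset.sum_neg_distrib] at h
  exact h

/-- Scaling space by `w` and time by `s` maps tempered stable subordinators to tempered stable
subordinators. -/
lemma IsTSSubordinator.scale (hL : IsTSSubordinator α β c L P) (hα0 : 0 < α) (hα1 : α < 1)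
    (hβ : 0 < β) {w s : ℝ≥0} (hw : 0 < w) (hs : 0 < s) :
    IsTSSubordinator α (β / w) (c * s * (w : ℝ) ^ α) (fun t ω ↦ w * L (s * t) ω) P where
  isLevyProcess :=
    { measurable := fun t ↦ ((hL.measurable _).const_mul _).coe_nnreal_real
      zero := by
        filter_upwards [hL.isLevyProcess.zero] with ω hω
        have : L 0 ω = 0 := by exact_mod_cast hω
        simp [this]
      indep_increments := fun n τ hτ ↦ by
        have h := (hL.isLevyProcess.indep_increments n (fun i ↦ s * τ i)
          (fun i j hij ↦ mul_le_mul_right (hτ hij) s)).comp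
          (fun _ x ↦ (w : ℝ) * x) (fun _ ↦ by fun_prop)
        convert! h using 3 with i
        simp only [Function.comp, NNReal.coe_mul]
        ring
      stationary_increments := fun p q ↦ by
        have h := (hL.isLevyProcess.stationary_increments (s * p) (s * q)).comp
          (u := fun x ↦ (w : ℝ) * x) (by fun_prop)
        convert! h using 1
        ext ω
        simp only [Function.comp, NNReal.coe_mul, mul_add]
        ring
      cadlag := by
        filter_upwards [hL.isLevyProcess.cadlag] with ω hω t
        obtain ⟨h1, l, h2⟩ := hω (s * t)
        have hsc : ContinuousAt (fun x : ℝ≥0 ↦ s * x) t := by fun_prop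
        constructor
        · simp only [NNReal.coe_mul]
          refine continuousWithinAt_const.mul (ContinuousWithinAt.comp
            (g := fun q ↦ (L q ω : ℝ)) (t := Set.Ici (s * t)) h1 hsc.continuousWithinAt ?_)
          exact fun x hx ↦ mul_le_mul_right (Set.mem_Ici.1 hx) s
        · refine ⟨w * l, ?_⟩
          simp only [NNReal.coe_mul]
          refine (h2.comp (tendsto_nhdsWithin_iff.2
            ⟨hsc.tendsto.mono_left nhdsWithin_le_nhds, ?_⟩)).const_mul _
          filter_upwards [self_mem_nhdsWithin] with x hx
          exact mul_lt_mul_of_pos_left hx hs }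
  monotone := by
    filter_upwards [hL.monotone] with ω hω p q hpq
    exact mul_le_mul_right (hω (mul_le_mul_right hpq s)) w
  law t := by
    have hw' : (0 : ℝ) < w := hw
    have hm : AEMeasurable (fun ω ↦ ((w * L (s * t) ω : ℝ≥0) : ℝ)) P :=
      ((hL.measurable _).const_mul _).coe_nnreal_real.aemeasurable
    have hm' : AEMeasurable (fun ω ↦ (L (s * t) ω : ℝ)) P :=
      (hL.isLevyProcess.measurable _).aemeasurable
    have hP : IsProbabilityMeasure P := by
      have := (hL.law 0).isProbabilityMeasure
      exact Measure.isProbabilityMeasure_of_map (fun ω ↦ (L 0 ω : ℝ))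
    refine ⟨Measure.isProbabilityMeasure_map hm, ?_, fun r hr ↦ ?_⟩
    · rw [ae_map_iff hm measurableSet_Ici]
      exact ae_of_all _ fun ω ↦ NNReal.coe_nonneg _
    · have h := (hL.law (s * t)).integral_exp hα0 hα1 hβ (mul_nonneg hw'.le hr)
      rw [integral_map hm' (by fun_prop), tsExponent_mul hβ hr hw'] at h
      rw [integral_map hm (by fun_prop),
        integral_one_sub_exp_mul_tsLevyDensity hα0 hα1 (div_pos hβ hw') hr]
      convert! h using 2
      · ext ω
        push_cast
        ring_nf
      · push_cast
        ring_nf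

end Subordinator

section SNTS

variable {Ω : Type*} [MeasurableSpace Ω] {P : Measure Ω} {σ α β c : ℝ}

lemma IsSNTSProcess.aemeasurable {Y : ℝ≥0 → Ω → ℝ} (hY : IsSNTSProcess σ α β c Y P) (t : ℝ≥0) :
    AEMeasurable (Y t) P := by
  obtain ⟨L, W, hL, hWm, hW, -, hYe⟩ := hY
  rw [show Y t = fun ω ↦ σ * W (L t ω) ω from funext fun ω ↦ hYe t ω]
  exact (aemeasurable_comp_time hWm hW (hL.measurable t)).const_mul _

/-- The joint characteristic function of the increments of a symmetric normal tempered stable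
process. -/
lemma IsSNTSProcess.integral_cexp_sum [IsProbabilityMeasure P] {Y : ℝ≥0 → Ω → ℝ}
    (hY : IsSNTSProcess σ α β c Y P) (hα0 : 0 < α) (hα1 : α < 1) (hβ : 0 < β) {n : ℕ}
    {τ : Fin (n + 1) → ℝ≥0} (hτ : Monotone τ) (u : Fin n → ℝ) :
    ∫ ω, Complex.exp (((∑ j, u j * (Y (τ j.succ) ω - Y (τ j.castSucc) ω) : ℝ) : ℂ) *
        Complex.I) ∂P =
      ((Real.exp (-∑ j, c * (τ j.succ - τ j.castSucc) *
        tsExponent α β ((u j * σ) ^ 2 / 2)) : ℝ) : ℂ) := by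
  obtain ⟨L, W, hL, hWm, hW, hind, hYe⟩ := hY
  have hind' : IndepFun (fun ω j ↦ L (τ j) ω) (fun ω t ↦ W t ω) P :=
    hind.comp (φ := fun x j ↦ x (τ j)) (ψ := id)
      (measurable_pi_lambda _ fun j ↦ measurable_pi_apply _) measurable_id
  have hmono : ∀ᵐ ω ∂P, Monotone fun j ↦ L (τ j) ω := by
    filter_upwards [hL.monotone] with ω hω using hω.comp hτ
  have h := integral_cexp_sum_comp_time hWm hW (T := fun j ↦ L (τ j))
    (fun j ↦ hL.measurable _) hmono hind' (fun j ↦ u j * σ)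
  rw [integral_complex_ofReal, hL.integral_exp_sum hα0 hα1 hβ hτ (fun j ↦ by positivity)] at h
  rw [← h]
  simp only [hYe, ← mul_sub, mul_assoc]

lemma IsSNTSProcess.integral_cexp [IsProbabilityMeasure P] {Y : ℝ≥0 → Ω → ℝ}
    (hY : IsSNTSProcess σ α β c Y P) (hα0 : 0 < α) (hα1 : α < 1) (hβ : 0 < β) (t : ℝ≥0) (u : ℝ) :
    ∫ ω, Complex.exp (((u * Y t ω : ℝ) : ℂ) * Complex.I) ∂P =
      ((Real.exp (-(c * t * tsExponent α β ((u * σ) ^ 2 / 2))) : ℝ) : ℂ) := by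
  have h0 : ∀ᵐ ω ∂P, Y 0 ω = 0 := by
    obtain ⟨L, W, hL, hWm, hW, hind, hYe⟩ := hY
    filter_upwards [hL.isLevyProcess.zero, hW.eval_zero_ae_eq_zero] with ω h1 h2
    have : L 0 ω = 0 := by exact_mod_cast h1
    rw [hYe, this, h2, mul_zero]
  have h := hY.integral_cexp_sum hα0 hα1 hβ (n := 1) (τ := ![0, t])
    (by intro i j hij; fin_cases i <;> fin_cases j <;> simp_all) (fun _ ↦ u)
  simp only [Finset.univ_unique, Finset.sum_singleton] at h
  simp only [Fin.default_eq_zero, Fin.isValue, Fin.succ_zero_eq_one, Matrix.cons_val_one,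
    Matrix.cons_val_fin_one, Fin.castSucc_zero, Matrix.cons_val_zero, NNReal.coe_zero,
    sub_zero] at h
  rw [← h]
  refine integral_congr_ae ?_
  filter_upwards [h0] with ω hω
  rw [hω, sub_zero]

/-- Scaling the subordinator of a symmetric normal tempered stable process produces every
tempered stable law with rate `β / w`, and every law with the characteristic function
of the corresponding symmetric normal tempered stable law. -/
lemma IsSNTSProcess.exists_isTSLaw {Ω : Type u} [MeasurableSpace Ω] {P : Measure Ω}
    [IsProbabilityMeasure P] {Y : ℝ≥0 → Ω → ℝ}
    (hY : IsSNTSProcess σ α β c Y P) (hα0 : 0 < α) (hα1 : α < 1) (hβ : 0 < β) (hc : 0 < c)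
    {w c' : ℝ} (hw : 0 < w) (hc' : 0 < c') :
    (∃ ν, IsTSLaw α (β / w) c' ν) ∧ ∀ μ : Measure ℝ, IsProbabilityMeasure μ →
      (∀ u, charFun μ u = ((Real.exp (-(c' * tsExponent α (β / w) ((u * σ) ^ 2 / 2))) : ℝ) : ℂ)) →
      IsSNTSLaw.{u} σ α (β / w) c' μ := by
  obtain ⟨L, W, hL, hWm, hW, hind, hYe⟩ := hY
  have hwα : 0 < w ^ α := Real.rpow_pos_of_pos hw _
  lift w to ℝ≥0 using hw.le
  obtain ⟨s, hs0, hcs⟩ : ∃ s : ℝ≥0, 0 < s ∧ c * s * (w : ℝ) ^ α = c' := by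
    refine ⟨⟨c' / (c * (w : ℝ) ^ α), by positivity⟩, ?_, ?_⟩
    · change 0 < c' / (c * (w : ℝ) ^ α)
      positivity
    · change c * (c' / (c * (w : ℝ) ^ α)) * (w : ℝ) ^ α = c'
      field_simp
  have hL' := hL.scale hα0 hα1 hβ (NNReal.coe_pos.1 hw) hs0
  rw [hcs] at hL'
  refine ⟨⟨_, by simpa using hL'.law 1⟩, fun μ hμ hchar ↦ ?_⟩
  set L' : ℝ≥0 → Ω → ℝ≥0 := fun t ω ↦ w * L (s * t) ω
  have hY' : IsSNTSProcess σ α (β / w) c' (fun t ω ↦ σ * W (L' t ω) ω) P := by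
    refine ⟨L', W, hL', hWm, hW, ?_, fun t ω ↦ rfl⟩
    exact hind.comp (φ := fun (x : ℝ≥0 → ℝ≥0) t ↦ w * x (s * t))
      (ψ := id) (measurable_pi_lambda _ fun j ↦ (measurable_pi_apply _).const_mul _) measurable_id
  refine ⟨Ω, _, P, _, inferInstance, hY', ⟨hY'.aemeasurable 1, ?_⟩⟩
  have := Measure.isProbabilityMeasure_map (hY'.aemeasurable 1)
  refine Measure.ext_of_charFun (funext fun u ↦ ?_)
  rw [hchar, charFun_apply_real, integral_map (hY'.aemeasurable 1) (by fun_prop)]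
  have h := hY'.integral_cexp hα0 hα1 (div_pos hβ hw) 1 u
  rw [NNReal.coe_one, mul_one] at h
  rw [← h]
  push_cast
  rfl

end SNTS

/-- A centred Gaussian variance mixture: the characteristic function of `σ √M X`. -/
lemma integral_cexp_sqrt_mul_gaussian {Ω : Type*} [MeasurableSpace Ω] {P : Measure Ω}
    [IsProbabilityMeasure P] {M X : Ω → ℝ} (hM : AEMeasurable M P) (hM0 : ∀ᵐ ω ∂P, 0 ≤ M ω)
    (hX : HasLaw X (gaussianReal 0 1) P) (hind : IndepFun M X P) (σ u : ℝ) :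
    ∫ ω, Complex.exp (((u * (σ * Real.sqrt (M ω) * X ω) : ℝ) : ℂ) * Complex.I) ∂P =
      ((∫ ω, Real.exp (-((u * σ) ^ 2 / 2) * M ω) ∂P : ℝ) : ℂ) := by
  have hXm := hX.aemeasurable
  set G : ℝ × ℝ → ℂ := fun p ↦
    Complex.exp (((u * (σ * Real.sqrt p.1 * p.2) : ℝ) : ℂ) * Complex.I) with hG
  have hGm : Measurable G := by simp only [hG]; fun_prop
  have hprod := (indepFun_iff_map_prod_eq_prod_map_map hM hXm).1 hind
  have : IsProbabilityMeasure (P.map M) := Measure.isProbabilityMeasure_map hM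
  have hinner : ∀ᵐ x ∂(P.map M), ∫ y, G (x, y) ∂(gaussianReal 0 1) =
      ((Real.exp (-((u * σ) ^ 2 / 2) * x) : ℝ) : ℂ) := by
    rw [ae_map_iff hM (measurableSet_eq_fun
      (hGm.stronglyMeasurable.integral_prod_right'.measurable) (by fun_prop))]
    filter_upwards [hM0] with ω hω
    have h := charFun_gaussianReal (μ := 0) (v := 1) (u * σ * Real.sqrt (M ω))
    rw [charFun_apply_real] at h
    have hsq : ((Real.sqrt (M ω) : ℝ) : ℂ) ^ 2 = (M ω : ℂ) := by
      exact_mod_cast Real.sq_sqrt hω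
    convert! h using 1
    · refine integral_congr_ae (ae_of_all _ fun y ↦ ?_)
      simp only [hG]
      push_cast
      ring_nf
    · push_cast
      rw [mul_pow, mul_pow, hsq]
      ring_nf
  calc _ = ∫ ω, G (M ω, X ω) ∂P := rfl
    _ = ∫ p, G p ∂((P.map M).prod (gaussianReal 0 1)) := by
      rw [← hX.map_eq, ← hprod, integral_map (hM.prodMk hXm) hGm.aestronglyMeasurable]
    _ = ∫ x, ∫ y, G (x, y) ∂(gaussianReal 0 1) ∂(P.map M) :=
      integral_prod _ (Integrable.of_bound hGm.aestronglyMeasurable 1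
        (ae_of_all _ fun p ↦ (Complex.norm_exp_ofReal_mul_I _).le))
    _ = ∫ x, ((Real.exp (-((u * σ) ^ 2 / 2) * x) : ℝ) : ℂ) ∂(P.map M) := integral_congr_ae hinner
    _ = _ := by rw [integral_complex_ofReal, integral_map hM (by fun_prop)]

/-! ### The law of the Ornstein-Uhlenbeck process -/

lemma tendsto_sum_uniform_partition {g : ℝ → ℝ} {t : ℝ} (ht : 0 ≤ t)
    (hg : ContinuousOn g (Set.Icc 0 t)) :
    Tendsto (fun m : ℕ ↦ ∑ i ∈ Finset.range (m + 1), (t / (m + 1)) * g (t * i / (m + 1))) atTop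
      (𝓝 (∫ s in (0 : ℝ)..t, g s)) := by
  rw [Metric.tendsto_atTop]
  intro ε hε
  have huc := isCompact_Icc.uniformContinuousOn_of_continuous hg
  rw [Metric.uniformContinuousOn_iff] at huc
  obtain ⟨δ, hδ, hgδ⟩ := huc (ε / (t + 1)) (by positivity)
  obtain ⟨M, hM⟩ := exists_nat_gt (t / δ)
  refine ⟨M, fun m hm ↦ ?_⟩
  have hm0 : (0 : ℝ) < m + 1 := by positivity
  set h : ℝ := t / (m + 1) with hh
  have hh0 : 0 ≤ h := by positivity
  have hhδ : h < δ := by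
    rw [hh, div_lt_iff₀ hm0, mul_comm, ← div_lt_iff₀ hδ]
    have : (M : ℝ) ≤ m := by exact_mod_cast hm
    linarith
  set a : ℕ → ℝ := fun i ↦ t * i / (m + 1) with ha
  have ha' : ∀ i, a (i + 1) = a i + h := fun i ↦ by
    simp only [ha, hh]; push_cast; ring
  have ham : ∀ i ≤ m + 1, a i ∈ Set.Icc 0 t := fun i hi ↦ by
    have hi' : (i : ℝ) ≤ m + 1 := by exact_mod_cast hi
    refine ⟨by positivity, ?_⟩
    simp only [ha]
    rw [div_le_iff₀ hm0]
    exact mul_le_mul_of_nonneg_left hi' ht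
  have hsub : ∀ i < m + 1, Set.uIcc (a i) (a (i + 1)) ⊆ Set.Icc 0 t := fun i hi ↦
    Set.uIcc_subset_Icc (ham i hi.le) (ham (i + 1) hi)
  have hint : ∀ i < m + 1, IntervalIntegrable g volume (a i) (a (i + 1)) := fun i hi ↦
    (hg.mono (hsub i hi)).intervalIntegrable
  have hsum := intervalIntegral.sum_integral_adjacent_intervals hint
  have ha0 : a 0 = 0 := by simp [ha]
  have han : a (m + 1) = t := by simp only [ha]; push_cast; field_simp
  rw [ha0, han] at hsum
  rw [dist_eq_norm, ← hsum, ← Finset.sum_sub_distrib]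
  have hterm : ∀ i ∈ Finset.range (m + 1),
      ‖h * g (a i) - ∫ s in a i..a (i + 1), g s‖ ≤ ε / (t + 1) * h := fun i hi ↦ by
    have hi' := Finset.mem_range.1 hi
    have e : h * g (a i) - ∫ s in a i..a (i + 1), g s =
        ∫ s in a i..a (i + 1), (g (a i) - g s) := by
      rw [intervalIntegral.integral_sub intervalIntegrable_const (hint i hi'),
        intervalIntegral.integral_const, ha', smul_eq_mul]
      ring
    rw [e]
    have hb := intervalIntegral.norm_integral_le_of_norm_le_const (a := a i) (b := a (i + 1))
      (f := fun s ↦ g (a i) - g s) (C := ε / (t + 1)) fun s hs ↦ by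
        have hs' := Set.uIoc_subset_uIcc hs
        refine le_of_lt ?_
        rw [← dist_eq_norm]
        refine hgδ _ (ham i hi'.le) _ (hsub i hi' hs') ?_
        rw [Set.uIcc_of_le (by rw [ha']; linarith), ha'] at hs'
        rw [dist_comm, Real.dist_eq, abs_of_nonneg (by linarith [hs'.1])]
        linarith [hs'.2]
    rw [ha', add_sub_cancel_left, abs_of_nonneg hh0] at hb
    rw [ha']
    exact hb
  calc _ ≤ ∑ i ∈ Finset.range (m + 1), ε / (t + 1) * h :=
        (norm_sum_le _ _).trans (Finset.sum_le_sum hterm)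
    _ = ε * (t / (t + 1)) := by
        rw [Finset.sum_const, Finset.card_range, nsmul_eq_mul, hh]; push_cast; field_simp
    _ < ε := mul_lt_of_lt_one_right hε (by rw [div_lt_one (by positivity)]; linarith)

/-- The characteristic function of the Ornstein-Uhlenbeck process: the left-endpoint sums along
uniform partitions have explicit characteristic functions, whose exponents are Riemann sums. -/
lemma IsOUProcess.integral_cexp {Ω : Type*} [MeasurableSpace Ω] {P : Measure Ω}
    [IsProbabilityMeasure P] {σ α β c b : ℝ} (hα0 : 0 < α) (hα1 : α < 1) (hβ : 0 < β)
    {Y N : ℝ≥0 → Ω → ℝ} {N₀ : Ω → ℝ} (hY : IsSNTSProcess σ α β c Y P) (hN₀ : AEMeasurable N₀ P)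
    (hindep : IndepFun N₀ (fun ω t ↦ Y t ω) P) (hN : IsOUProcess b Y N₀ N P) (t : ℝ≥0) (u : ℝ) :
    ∫ ω, Complex.exp (((u * N t ω : ℝ) : ℂ) * Complex.I) ∂P =
      (∫ ω, Complex.exp (((u * (Real.exp (-b * t) * N₀ ω) : ℝ) : ℂ) * Complex.I) ∂P) *
      ((Real.exp (-(c * ∫ s in (0 : ℝ)..t,
        tsExponent α β ((u * σ) ^ 2 / 2 * Real.exp (-2 * b * s)))) : ℝ) : ℂ) := by
  set a : ℝ := Real.exp (-b * t) with ha
  set f : ℝ≥0 → ℝ := fun s ↦ Real.exp (-b * ((t : ℝ) - s)) with hf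
  set τ : ℕ → ℕ → ℝ≥0 := fun m i ↦ t * i / (m + 1) with hτ
  have hτmono : ∀ m, Monotone (τ m) := fun m i j hij ↦ by
    simp only [hτ]
    gcongr
  have hτstep : ∀ m i, (τ m (i + 1) : ℝ) - τ m i = t / (m + 1) := fun m i ↦ by
    simp only [hτ]; push_cast; ring
  set S : ℕ → Ω → ℝ := fun m ω ↦
    ∑ i ∈ Finset.range (m + 1), f (τ m i) * (Y (τ m (i + 1)) ω - Y (τ m i) ω) with hS
  have hlim : TendstoInMeasure P S atTop (fun ω ↦ N t ω - a * N₀ ω) := by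
    refine hN.solution t (fun m ↦ m + 1) τ hτmono (fun m ↦ by simp [hτ]) (fun m ↦ ?_)
      fun ε hε ↦ ?_
    · simp only [hτ]; push_cast; field_simp
    · obtain ⟨M, hM⟩ := exists_nat_gt ((t : ℝ) / ε)
      filter_upwards [eventually_ge_atTop M] with m hm i _
      have : (M : ℝ) ≤ m := by exact_mod_cast hm
      rw [hτstep, div_le_iff₀ (by positivity), mul_comm, ← div_le_iff₀ hε]
      linarith
  have hSm : ∀ m, AEMeasurable (S m) P := fun m ↦
    Finset.aemeasurable_fun_sum _ fun i _ ↦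
      ((hY.aemeasurable _).sub (hY.aemeasurable _)).const_mul _
  set g : ℝ → ℝ := fun s ↦ tsExponent α β ((u * σ) ^ 2 / 2 * Real.exp (-2 * b * (t - s))) with hg
  have hgc : Continuous g :=
    continuousOn_univ.1 ((continuousOn_tsExponent hβ).comp (by fun_prop) fun s _ ↦
      mul_nonneg (by positivity) (Real.exp_pos _).le)
  -- the characteristic functions of the Riemann sums
  have hchar : ∀ m, ∫ ω, Complex.exp (((u * (a * N₀ ω + S m ω) : ℝ) : ℂ) * Complex.I) ∂P =
      (∫ ω, Complex.exp (((u * (a * N₀ ω) : ℝ) : ℂ) * Complex.I) ∂P) *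
      ((Real.exp (-(c * ∑ i ∈ Finset.range (m + 1),
        ((t : ℝ) / (m + 1)) * g (t * i / (m + 1)))) : ℝ) : ℂ) := fun m ↦ by
    have h1 : ∀ ω, Complex.exp (((u * (a * N₀ ω + S m ω) : ℝ) : ℂ) * Complex.I) =
        Complex.exp (((u * (a * N₀ ω) : ℝ) : ℂ) * Complex.I) *
          Complex.exp (((u * S m ω : ℝ) : ℂ) * Complex.I) := fun ω ↦ by
      rw [← Complex.exp_add]; push_cast; ring_nf
    have hind : IndepFun (fun ω ↦ Complex.exp (((u * (a * N₀ ω) : ℝ) : ℂ) * Complex.I))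
        (fun ω ↦ Complex.exp (((u * S m ω : ℝ) : ℂ) * Complex.I)) P :=
      hindep.comp (φ := fun x ↦ Complex.exp (((u * (a * x) : ℝ) : ℂ) * Complex.I))
        (ψ := fun y : ℝ≥0 → ℝ ↦ Complex.exp (((u * ∑ i ∈ Finset.range (m + 1),
          f (τ m i) * (y (τ m (i + 1)) - y (τ m i)) : ℝ) : ℂ) * Complex.I))
        (by fun_prop) (by fun_prop)
    have hmeas : ∀ x : Ω → ℝ, AEMeasurable x P →
        AEStronglyMeasurable (fun ω ↦ Complex.exp (((u * x ω : ℝ) : ℂ) * Complex.I)) P :=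
      fun x hx ↦ ((Complex.measurable_exp.comp (g := Complex.exp)
        (f := fun y : ℝ ↦ ((u * y : ℝ) : ℂ) * Complex.I)
        (by fun_prop)).comp_aemeasurable hx).aestronglyMeasurable
    simp_rw [h1]
    rw [hind.integral_fun_mul_eq_mul_integral (hmeas _ (hN₀.const_mul a)) (hmeas _ (hSm m))]
    congr 1
    have hinc := hY.integral_cexp_sum hα0 hα1 hβ (n := m + 1) (τ := fun j ↦ τ m j)
      (fun i j hij ↦ hτmono m hij) (fun j ↦ u * f (τ m j))
    simp only [Fin.val_succ, Fin.val_castSucc] at hinc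
    rw [Fin.sum_univ_eq_sum_range (fun i ↦ c * ((τ m (i + 1) : ℝ) - τ m i) *
      tsExponent α β ((u * f (τ m i) * σ) ^ 2 / 2))] at hinc
    convert! hinc using 1
    · refine integral_congr_ae (ae_of_all _ fun ω ↦ ?_)
      dsimp only
      rw [Fin.sum_univ_eq_sum_range (fun i ↦ u * f (τ m i) *
        (Y (τ m (i + 1)) ω - Y (τ m i) ω)), hS, Finset.mul_sum]
      simp only [mul_assoc]
    · congr 3
      rw [Finset.mul_sum]
      refine Finset.sum_congr rfl fun i _ ↦ ?_
      rw [hτstep, mul_assoc]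
      have e : (u * f (τ m i) * σ) ^ 2 / 2 =
          (u * σ) ^ 2 / 2 * Real.exp (-2 * b * (t - t * i / (m + 1))) := by
        have e2 : f (τ m i) ^ 2 = Real.exp (-2 * b * (t - t * i / (m + 1))) := by
          simp only [hf, hτ]
          rw [← Real.exp_nat_mul]
          push_cast
          ring_nf
        rw [← e2]; ring
      rw [e]
  have hlim2 : Tendsto (fun m ↦ ∫ ω, Complex.exp (((u * (a * N₀ ω + S m ω) : ℝ) : ℂ) *
      Complex.I) ∂P) atTop (𝓝 ((∫ ω, Complex.exp (((u * (a * N₀ ω) : ℝ) : ℂ) * Complex.I) ∂P) *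
      ((Real.exp (-(c * ∫ s in (0 : ℝ)..t, g s)) : ℝ) : ℂ))) := by
    simp_rw [hchar]
    refine Tendsto.const_mul _ ((Complex.continuous_ofReal.tendsto _).comp
      ((Real.continuous_exp.tendsto _).comp (Tendsto.neg (Tendsto.const_mul _ ?_))))
    exact tendsto_sum_uniform_partition t.2 hgc.continuousOn
  have hsubst : ∫ s in (0 : ℝ)..t, g s =
      ∫ s in (0 : ℝ)..t, tsExponent α β ((u * σ) ^ 2 / 2 * Real.exp (-2 * b * s)) := by
    simp only [hg]
    rw [intervalIntegral.integral_comp_sub_left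
      (fun s ↦ tsExponent α β ((u * σ) ^ 2 / 2 * Real.exp (-2 * b * s)))]
    simp
  rw [← hsubst]
  obtain ⟨ns, hns, hae⟩ := hlim.exists_seq_tendsto_ae
  refine tendsto_nhds_unique ?_ (hlim2.comp hns.tendsto_atTop)
  refine tendsto_integral_of_dominated_convergence (fun _ ↦ 1) (fun m ↦ ?_)
    (integrable_const _) (fun m ↦ ae_of_all _ fun ω ↦ (Complex.norm_exp_ofReal_mul_I _).le) ?_
  · have h : AEMeasurable (fun ω ↦ a * N₀ ω + S (ns m) ω) P := (hN₀.const_mul a).add (hSm _)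
    exact ((show Measurable fun y : ℝ ↦ Complex.exp (((u * y : ℝ) : ℂ) * Complex.I) by
      fun_prop).comp_aemeasurable h).aestronglyMeasurable
  · filter_upwards [hae] with ω hω
    have h := hω.const_add (a * N₀ ω)
    rw [add_sub_cancel] at h
    exact ((show Continuous fun y : ℝ ↦ Complex.exp (((u * y : ℝ) : ℂ) * Complex.I) by
      fun_prop).tendsto _).comp h

/-! ### Compound Poisson sums -/

/-- Disjoint, possibly infinite, subfamilies of an independent family are independent. -/
lemma ProbabilityTheory.iIndepFun.indepFun_restrict_of_disjoint {Ω ι : Type*} [MeasurableSpace Ω]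
    {P : Measure Ω} {X : ι → Ω → ℝ} (hX : iIndepFun X P) (hm : ∀ i, Measurable (X i)) {S T : Set ι}
    (hST : Disjoint S T) :
    IndepFun (fun ω (i : S) ↦ X i ω) (fun ω (i : T) ↦ X i ω) P := by
  have h := indep_iSup_of_disjoint (fun i ↦ (hm i).comap_le) hX.iIndep hST
  rw [IndepFun_iff_Indep]
  simpa only [MeasurableSpace.pi, MeasurableSpace.comap_iSup, MeasurableSpace.comap_comp,
    Function.comp_def, iSup_subtype'] using h

/-- The Laplace transform of a compound Poisson sum; the number of summands is read off from the
first variable of an independent sequence, the summands are the others. -/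
lemma integral_exp_compoundPoisson {Ω : Type*} [MeasurableSpace Ω] {P : Measure Ω}
    [IsProbabilityMeasure P] {Z : ℕ → Ω → ℝ} (hZ : iIndepFun Z P) (hm : ∀ i, Measurable (Z i))
    {l : ℝ≥0} (hK : HasLaw (fun ω ↦ ⌊Z 0 ω⌋₊) (poissonMeasure l) P) {ν : Measure ℝ}
    (hJ : ∀ k, HasLaw (Z (k + 1)) ν P) (hν : ∀ᵐ x ∂ν, 0 ≤ x) {r : ℝ} (hr : 0 ≤ r) :
    ∫ ω, Real.exp (-r * ∑ k ∈ Finset.range ⌊Z 0 ω⌋₊, Z (k + 1) ω) ∂P =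
      Real.exp (-(l * (1 - ∫ x, Real.exp (-r * x) ∂ν))) := by
  set q := ∫ x, Real.exp (-r * x) ∂ν with hq
  have hKm : Measurable fun ω ↦ ⌊Z 0 ω⌋₊ := Nat.measurable_floor.comp (hm 0)
  have hJm : Measurable fun ω (k : ℕ) ↦ Z (k + 1) ω := measurable_pi_lambda _ fun k ↦ hm _
  have hind : IndepFun (fun ω ↦ ⌊Z 0 ω⌋₊) (fun ω (k : ℕ) ↦ Z (k + 1) ω) P := by
    have h := hZ.indepFun_restrict_of_disjoint hm (S := {0}) (T := {0}ᶜ) disjoint_compl_right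
    exact h.comp (φ := fun x : ({0} : Set ℕ) → ℝ ↦ ⌊x ⟨0, rfl⟩⌋₊) (ψ := fun x k ↦ x ⟨k + 1, by simp⟩)
      (Nat.measurable_floor.comp (measurable_pi_apply (⟨0, rfl⟩ : ({0} : Set ℕ))))
      (measurable_pi_lambda _ fun k ↦ measurable_pi_apply _)
  have hZ0 : ∀ᵐ ω ∂P, ∀ k, 0 ≤ Z (k + 1) ω := ae_all_iff.2 fun k ↦ by
    have h := hν
    rw [← (hJ k).map_eq, ae_map_iff (hm _).aemeasurable measurableSet_Ici] at h
    exact h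
  set G : ℕ × (ℕ → ℝ) → ℝ := fun p ↦ Real.exp (-r * ∑ k ∈ Finset.range p.1, p.2 k) with hG
  have hGm : Measurable G := measurable_from_prod_countable_right fun k ↦ by
    simp only [hG]; fun_prop
  have hprod := (indepFun_iff_map_prod_eq_prod_map_map hKm.aemeasurable hJm.aemeasurable).1 hind
  rw [hK.map_eq] at hprod
  have : IsProbabilityMeasure (P.map fun ω (k : ℕ) ↦ Z (k + 1) ω) :=
    Measure.isProbabilityMeasure_map hJm.aemeasurable
  have hinner : ∀ k, ∫ x, G (k, x) ∂(P.map fun ω (k : ℕ) ↦ Z (k + 1) ω) = q ^ k := fun k ↦ by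
    have hGk : Measurable fun x ↦ G (k, x) := hGm.comp measurable_prodMk_left
    rw [integral_map hJm.aemeasurable hGk.aestronglyMeasurable]
    have hinj : Function.Injective fun j : Fin k ↦ (j : ℕ) + 1 := fun i j h ↦ by
      simpa [Fin.ext_iff] using h
    have h := (hZ.precomp hinj).integral_fun_prod_comp (𝕜 := ℝ)
      (f := fun _ x ↦ Real.exp (-r * x)) (fun j ↦ (hm _).aemeasurable) (fun j ↦ by fun_prop)
    have hfac : ∀ j : Fin k, ∫ ω, Real.exp (-r * Z (j + 1) ω) ∂P = q := fun j ↦ by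
      rw [hq, ← (hJ j).map_eq, integral_map (hm _).aemeasurable (by fun_prop)]
    simp only [hfac, Finset.prod_const, Finset.card_univ, Fintype.card_fin, ← Real.exp_sum] at h
    rw [← h]
    refine integral_congr_ae (ae_of_all _ fun ω ↦ ?_)
    simp only [hG, ← Finset.mul_sum, Fin.sum_univ_eq_sum_range (fun i ↦ Z (i + 1) ω)]
  have hGint : Integrable G ((poissonMeasure l).prod (P.map fun ω (k : ℕ) ↦ Z (k + 1) ω)) := by
    rw [← hprod, integrable_map_measure hGm.aestronglyMeasurable (hKm.prodMk hJm).aemeasurable]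
    refine Integrable.of_bound (hGm.comp (hKm.prodMk hJm)).aestronglyMeasurable 1 ?_
    filter_upwards [hZ0] with ω hω
    simp only [Function.comp, hG]
    rw [Real.norm_of_nonneg (Real.exp_pos _).le, Real.exp_le_one_iff, neg_mul, neg_nonpos]
    exact mul_nonneg hr (Finset.sum_nonneg fun k _ ↦ hω k)
  calc _ = ∫ ω, G (⌊Z 0 ω⌋₊, fun k ↦ Z (k + 1) ω) ∂P := rfl
    _ = ∫ p, G p ∂((poissonMeasure l).prod (P.map fun ω (k : ℕ) ↦ Z (k + 1) ω)) := by
      rw [← hprod, integral_map (hKm.prodMk hJm).aemeasurable hGm.aestronglyMeasurable]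
    _ = ∫ k, q ^ k ∂(poissonMeasure l) := by
      rw [integral_prod _ hGint]
      simp_rw [hinner]
    _ = ∑' k : ℕ, Real.exp (-l) * ((l * q) ^ k / (k.factorial : ℝ)) := by
      rw [integral_poissonMeasure]
      congr 1 with k
      rw [smul_eq_mul, mul_pow]
      ring
    _ = _ := by
      rw [tsum_mul_left, ← congrFun NormedSpace.exp_eq_tsum_div (l * q : ℝ), ← Real.exp_eq_exp_ℝ,
        ← Real.exp_add]
      ring_nf

/-! ### The decomposition -/

/-- The laws of the building blocks, arranged in three rows, one for each summand: the initial
value; a normal and a tempered stable variable; a normal variable, a Poisson variable and the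
jumps. Row `0` repeats the initial law, and row `1` the tempered stable law, in unused places. -/
noncomputable def blockLaw (μ₀ ν ρ κ : Measure ℝ) : Fin 3 → ℕ → Measure ℝ
  | 0, _ => μ₀
  | 1, 0 => gaussianReal 0 1
  | 1, _ + 1 => ν
  | 2, 0 => gaussianReal 0 1
  | 2, 1 => ρ
  | 2, _ + 2 => κ

instance (μ₀ ν ρ κ : Measure ℝ) [IsProbabilityMeasure μ₀] [IsProbabilityMeasure ν]
    [IsProbabilityMeasure ρ] [IsProbabilityMeasure κ] (i : Fin 3) (j : ℕ) :
    IsProbabilityMeasure (blockLaw μ₀ ν ρ κ i j) := by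
  fin_cases i <;> rcases j with _ | _ | j <;> (simp only [blockLaw]; infer_instance)

lemma map_floor_map_natCast (ρ : Measure ℕ) :
    (ρ.map (Nat.cast : ℕ → ℝ)).map (fun x ↦ ⌊x⌋₊) = ρ := by
  rw [Measure.map_map Nat.measurable_floor (by fun_prop)]
  have : (fun x : ℝ ↦ ⌊x⌋₊) ∘ (Nat.cast : ℕ → ℝ) = id := by ext n; simp
  rw [this, Measure.map_id]

lemma ProbabilityTheory.iIndepFun.integral_cexp_add_three {Ω : Type*} [MeasurableSpace Ω]
    {P : Measure Ω}
    {A B C : Ω → ℝ} (h : iIndepFun ![A, B, C] P) (hA : Measurable A) (hB : Measurable B)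
    (hC : Measurable C) (u : ℝ) :
    ∫ ω, Complex.exp (((u * (A ω + B ω + C ω) : ℝ) : ℂ) * Complex.I) ∂P =
      (∫ ω, Complex.exp (((u * A ω : ℝ) : ℂ) * Complex.I) ∂P) *
      (∫ ω, Complex.exp (((u * B ω : ℝ) : ℂ) * Complex.I) ∂P) *
      ∫ ω, Complex.exp (((u * C ω : ℝ) : ℂ) * Complex.I) ∂P := by
  have h := h.integral_fun_prod_comp (𝕜 := ℂ)
    (f := fun _ x ↦ Complex.exp (((u * x : ℝ) : ℂ) * Complex.I))
    (fun i ↦ by fin_cases i <;> simp <;> fun_prop) (fun i ↦ by fun_prop)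
  simp only [Fin.prod_univ_three, Matrix.cons_val_zero, Matrix.cons_val_one,
    Matrix.cons_val] at h
  rw [← h]
  refine integral_congr_ae (ae_of_all _ fun ω ↦ ?_)
  simp only [← Complex.exp_add]
  push_cast
  ring_nf

/-- The joint law of the building blocks: all of them are independent. -/
noncomputable def blockMeasure (μ₀ ν ρ κ : Measure ℝ) [IsProbabilityMeasure μ₀]
    [IsProbabilityMeasure ν] [IsProbabilityMeasure ρ] [IsProbabilityMeasure κ] :
    Measure (Fin 3 → ℕ → ℝ) :=
  Measure.infinitePi fun i ↦ Measure.infinitePi (blockLaw μ₀ ν ρ κ i)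

/-- The compound Poisson sum of the third row: the integer part of the entry `1` is the number
of summands, which are the entries from `2` on. -/
noncomputable def rowSum (x : ℕ → ℝ) : ℝ := ∑ k ∈ Finset.range ⌊x 1⌋₊, x (k + 2)

lemma measurable_rowSum : Measurable rowSum := by
  have h1 : Measurable fun p : ℕ × (ℕ → ℝ) ↦ ∑ k ∈ Finset.range p.1, p.2 (k + 2) :=
    measurable_from_prod_countable_right fun k ↦ by dsimp only; fun_prop
  exact h1.comp ((Nat.measurable_floor.comp (measurable_pi_apply 1)).prodMk measurable_id)

/-- The place of each building block in the three rows. -/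
def blockIndex : Fin 5 ⊕ ℕ → Fin 3 × ℕ
  | .inl 0 => (0, 0)
  | .inl 1 => (1, 0)
  | .inl 2 => (1, 1)
  | .inl 3 => (2, 0)
  | .inl 4 => (2, 1)
  | .inr k => (2, k + 2)

lemma blockIndex_injective : Function.Injective blockIndex := by
  rintro (i | i) (j | j) h
  · revert h; revert i j; decide
  · revert h; fin_cases i <;> simp [blockIndex]
  · revert h; fin_cases j <;> simp [blockIndex]
  · simpa [blockIndex] using h

section Block

variable {μ₀ ν ρ κ : Measure ℝ} [IsProbabilityMeasure μ₀] [IsProbabilityMeasure ν]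
  [IsProbabilityMeasure ρ] [IsProbabilityMeasure κ]

instance : IsProbabilityMeasure (blockMeasure μ₀ ν ρ κ) := by
  unfold blockMeasure; infer_instance

lemma hasLaw_blockMeasure (i : Fin 3) (j : ℕ) :
    HasLaw (fun ω : Fin 3 → ℕ → ℝ ↦ ω i j) (blockLaw μ₀ ν ρ κ i j) (blockMeasure μ₀ ν ρ κ) :=
  ((measurePreserving_eval_infinitePi (blockLaw μ₀ ν ρ κ i) j).comp
    (measurePreserving_eval_infinitePi
      (fun i ↦ Measure.infinitePi (blockLaw μ₀ ν ρ κ i)) i)).hasLaw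

lemma iIndepFun_blockMeasure :
    iIndepFun (fun (p : Fin 3 × ℕ) (ω : Fin 3 → ℕ → ℝ) ↦ ω p.1 p.2) (blockMeasure μ₀ ν ρ κ) :=
  iIndepFun_uncurry_infinitePi' (X := fun _ _ x ↦ x) (blockLaw μ₀ ν ρ κ) (fun _ _ ↦ measurable_id)

lemma iIndepFun_rows_blockMeasure {f g h : (ℕ → ℝ) → ℝ} (hf : Measurable f) (hg : Measurable g)
    (hh : Measurable h) :
    iIndepFun ![fun ω : Fin 3 → ℕ → ℝ ↦ f (ω 0), fun ω ↦ g (ω 1), fun ω ↦ h (ω 2)]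
      (blockMeasure μ₀ ν ρ κ) := by
  have h := iIndepFun_infinitePi (P := fun i ↦ Measure.infinitePi (blockLaw μ₀ ν ρ κ i))
    (X := ![f, g, h]) (fun i ↦ by
      fin_cases i
      · exact hf
      · exact hg
      · exact hh)
  convert! h using 1
  ext i ω
  fin_cases i <;> rfl

lemma iIndepFun_blocks :
    iIndepFun (Sum.elim ![fun ω : Fin 3 → ℕ → ℝ ↦ ω 0 0, fun ω ↦ ω 1 0, fun ω ↦ ω 1 1,
      fun ω ↦ ω 2 0, fun ω ↦ ((⌊ω 2 1⌋₊ : ℕ) : ℝ)] fun k ω ↦ ω 2 (k + 2))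
      (blockMeasure μ₀ ν ρ κ) := by
  -- the Poisson entry is only almost surely an integer, hence the integer part
  set φ : Fin 5 ⊕ ℕ → ℝ → ℝ := fun i x ↦ if i = Sum.inl 4 then (⌊x⌋₊ : ℝ) else x with hφ
  have hφm : ∀ i, Measurable (φ i) := fun i ↦ by
    by_cases h : i = Sum.inl 4
    · simp only [hφ, if_pos h]
      exact measurable_from_nat.comp Nat.measurable_floor
    · simp only [hφ, if_neg h]
      exact measurable_id
  convert! (iIndepFun_blockMeasure.precomp blockIndex_injective).comp φ hφm using 1
  funext i
  rcases i with i | i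
  · fin_cases i <;> rfl
  · rfl

/-- The characteristic function of the Gaussian mixture with tempered stable variance. -/
lemma integral_cexp_row_one {α β c σ : ℝ} (hα0 : 0 < α) (hα1 : α < 1) (hβ : 0 < β)
    (hν : IsTSLaw α β c ν) (u : ℝ) :
    ∫ ω, Complex.exp (((u * (σ * Real.sqrt (ω 1 1) * ω 1 0) : ℝ) : ℂ) * Complex.I)
        ∂(blockMeasure μ₀ ν ρ κ) =
      ((Real.exp (-(c * tsExponent α β ((u * σ) ^ 2 / 2))) : ℝ) : ℂ) := by
  have hm : Measurable fun ω : Fin 3 → ℕ → ℝ ↦ ω 1 1 := by fun_prop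
  have hlaw : (blockMeasure μ₀ ν ρ κ).map (fun ω ↦ ω 1 1) = ν := (hasLaw_blockMeasure 1 1).map_eq
  have hM0 : ∀ᵐ ω ∂(blockMeasure μ₀ ν ρ κ), 0 ≤ ω 1 1 := by
    have h := hν.nonneg
    rw [← hlaw, ae_map_iff hm.aemeasurable measurableSet_Ici] at h
    exact h
  rw [integral_cexp_sqrt_mul_gaussian hm.aemeasurable hM0 (hasLaw_blockMeasure 1 0)
    (iIndepFun_blockMeasure.indepFun (i := (1, 1)) (j := (1, 0)) (by simp)) σ u,
    ← hν.integral_exp hα0 hα1 hβ (by positivity)]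
  conv_rhs => rw [← hlaw]
  rw [integral_map hm.aemeasurable (by fun_prop)]

/-- The characteristic function of the Gaussian mixture with compound Poisson variance. -/
lemma integral_cexp_row_two {l : ℝ≥0} {σ : ℝ}
    (hK : HasLaw (fun ω : Fin 3 → ℕ → ℝ ↦ ⌊ω 2 1⌋₊) (poissonMeasure l) (blockMeasure μ₀ ν ρ κ))
    (hκ : ∀ᵐ x ∂κ, 0 ≤ x) (u : ℝ) :
    ∫ ω, Complex.exp (((u * (σ * Real.sqrt (rowSum (ω 2)) * ω 2 0) : ℝ) : ℂ) * Complex.I)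
        ∂(blockMeasure μ₀ ν ρ κ) =
      ((Real.exp (-(l * (1 - ∫ x, Real.exp (-((u * σ) ^ 2 / 2) * x) ∂κ))) : ℝ) : ℂ) := by
  have hm : ∀ j, Measurable fun ω : Fin 3 → ℕ → ℝ ↦ ω 2 j := fun j ↦ by fun_prop
  have hI2 : iIndepFun (fun (j : ℕ) (ω : Fin 3 → ℕ → ℝ) ↦ ω 2 j) (blockMeasure μ₀ ν ρ κ) :=
    iIndepFun_blockMeasure.precomp (g := fun j : ℕ ↦ ((2 : Fin 3), j)) fun i j h ↦ by simpa using h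
  have hlaw : ∀ k, HasLaw (fun ω : Fin 3 → ℕ → ℝ ↦ ω 2 (k + 2)) κ (blockMeasure μ₀ ν ρ κ) :=
    fun k ↦ hasLaw_blockMeasure 2 (k + 2)
  have hM0 : ∀ᵐ ω ∂(blockMeasure μ₀ ν ρ κ), 0 ≤ rowSum (ω 2) := by
    have : ∀ᵐ ω ∂(blockMeasure μ₀ ν ρ κ), ∀ k, 0 ≤ ω 2 (k + 2) := ae_all_iff.2 fun k ↦ by
      have h := hκ
      rw [← (hlaw k).map_eq, ae_map_iff (hm _).aemeasurable measurableSet_Ici] at h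
      exact h
    filter_upwards [this] with ω hω using Finset.sum_nonneg fun k _ ↦ hω k
  have hind : IndepFun (fun ω ↦ rowSum (ω 2)) (fun ω ↦ ω 2 0) (blockMeasure μ₀ ν ρ κ) := by
    have h := hI2.indepFun_restrict_of_disjoint hm (S := {0}ᶜ) (T := {0}) disjoint_compl_left
    -- `rowSum` does not see the entry `0`, which may be filled arbitrarily
    have hψ : Measurable fun (x : ({0}ᶜ : Set ℕ) → ℝ) (j : ℕ) ↦
        if h : j = 0 then 0 else x ⟨j, h⟩ := measurable_pi_lambda _ fun j ↦ by
      by_cases h : j = 0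
      · simp [h]
      · simpa [h] using measurable_pi_apply _
    have h2 := h.comp (measurable_rowSum.comp hψ)
      (measurable_pi_apply (⟨0, rfl⟩ : ({0} : Set ℕ)))
    convert! h2 using 1
  have hR : Measurable fun ω : Fin 3 → ℕ → ℝ ↦ rowSum (ω 2) :=
    measurable_rowSum.comp (measurable_pi_apply 2)
  rw [integral_cexp_sqrt_mul_gaussian hR.aemeasurable hM0 (hasLaw_blockMeasure 2 0) hind σ u]
  exact congrArg _ (integral_exp_compoundPoisson
    (Z := fun (j : ℕ) (ω : Fin 3 → ℕ → ℝ) ↦ ω 2 (j + 1))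
    (hI2.precomp (add_left_injective 1)) (fun j ↦ hm (j + 1)) hK hlaw hκ (by positivity))

end Block

theorem mainTheorem1 {Ω : Type u} [MeasurableSpace Ω] (P : Measure Ω) [IsProbabilityMeasure P]
    (σ α β c b : ℝ) (hσ : 0 < σ) (hα0 : 0 < α) (hα1 : α < 1) (hβ : 0 < β) (hc : 0 < c)
    (hb : 0 < b)
    (Y N : ℝ≥0 → Ω → ℝ) (N₀ : Ω → ℝ)
    (hY : IsSNTSProcess σ α β c Y P)
    (hN₀ : AEMeasurable N₀ P)
    (hindep : IndepFun N₀ (fun ω t ↦ Y t ω) P)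
    (hN : IsOUProcess b Y N₀ N P)
    (t : ℝ≥0) (ht : 0 < t) (a w : ℝ) (ha : a = Real.exp (-b * t)) (hw : w = a ^ 2) :
    0 < poissonIntensity α β c b w ∧
    IsProbabilityMeasure (rateLaw α w) ∧
    IsProbabilityMeasure (jumpLaw α β w) ∧
    -- the jump law is the mixture of gamma laws with random rate `β V`, `V` of density `f_V`
    (∀ s : Set ℝ, MeasurableSet s →
      jumpLaw α β w s = ∫⁻ v, gammaMeasure (1 - α) (β * v) s ∂(rateLaw α w)) ∧
    ∃ (Ω' : Type) (_ : MeasurableSpace Ω') (P' : Measure Ω')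
      (N₀' N₁ N₂ X₁ M₁ X₂ M₂ : Ω' → ℝ) (K : Ω' → ℕ) (J : ℕ → Ω' → ℝ),
      IsProbabilityMeasure P' ∧
      -- the three summands
      IdentDistrib N₀' N₀ P' P ∧
      iIndepFun ![fun ω ↦ a * N₀' ω, N₁, N₂] P' ∧
      IdentDistrib (N t) (fun ω ↦ a * N₀' ω + N₁ ω + N₂ ω) P P' ∧
      -- the building blocks are jointly independent
      iIndepFun (Sum.elim ![N₀', X₁, M₁, X₂, fun ω ↦ (K ω : ℝ)] J) P' ∧
      -- the first mixture
      (∀ ω, N₁ ω = σ * Real.sqrt (M₁ ω) * X₁ ω) ∧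
      HasLaw X₁ (gaussianReal 0 1) P' ∧
      AEMeasurable M₁ P' ∧
      IsTSLaw α (β / w) (c * ((1 - w ^ α) / (2 * α * b))) (P'.map M₁) ∧
      IsSNTSLaw.{u} σ α (β / w) (c * ((1 - w ^ α) / (2 * α * b))) (P'.map N₁) ∧
      -- the second mixture
      (∀ ω, N₂ ω = σ * Real.sqrt (M₂ ω) * X₂ ω) ∧
      HasLaw X₂ (gaussianReal 0 1) P' ∧
      (∀ ω, M₂ ω = ∑ k ∈ Finset.range (K ω), J k ω) ∧
      HasLaw K (poissonMeasure (poissonIntensity α β c b w).toNNReal) P' ∧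
      ∀ k, HasLaw (J k) (jumpLaw α β w) P' := by
  have hwexp : w = Real.exp (-2 * b * t) := by
    rw [hw, ha, ← Real.exp_nat_mul]; push_cast; ring_nf
  have hw0 : 0 < w := hwexp ▸ Real.exp_pos _
  have hw1 : w < 1 := by
    rw [hwexp, Real.exp_lt_one_iff]
    have : 0 < b * (t : ℝ) := mul_pos hb ht
    linarith
  have hΛ := poissonIntensity_pos hα0 hα1 hβ hc hb hw0 hw1
  have hjump := isProbabilityMeasure_jumpLaw hα0 hα1 hβ hw0 hw1
  refine ⟨hΛ, isProbabilityMeasure_rateLaw hα0 hw0 hw1, hjump,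
    fun s hs ↦ jumpLaw_apply hα0 hα1 hβ hw0 hw1 hs, ?_⟩
  set Λ := poissonIntensity α β c b w with hΛdef
  set c' := c * ((1 - w ^ α) / (2 * α * b)) with hc'def
  have hc' : 0 < c' := by
    have : 0 < 1 - w ^ α := sub_pos.2 (Real.rpow_lt_one hw0.le hw1 hα0)
    positivity
  obtain ⟨⟨ν, hν⟩, hSNTS⟩ := hY.exists_isTSLaw hα0 hα1 hβ hc hw0 hc'
  have hνp := hν.isProbabilityMeasure
  have hN₀p := Measure.isProbabilityMeasure_map hN₀
  set ρ : Measure ℝ := (poissonMeasure Λ.toNNReal).map Nat.cast with hρ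
  have hρp : IsProbabilityMeasure ρ := Measure.isProbabilityMeasure_map (by fun_prop)
  set Q := blockMeasure (P.map N₀) ν ρ (jumpLaw α β w) with hQ
  have hlaw : ∀ i j, HasLaw (fun ω : Fin 3 → ℕ → ℝ ↦ ω i j) _ Q := hasLaw_blockMeasure
  have hKlaw : HasLaw (fun ω : Fin 3 → ℕ → ℝ ↦ ⌊ω 2 1⌋₊) (poissonMeasure Λ.toNNReal) Q := by
    have hm : Measurable fun ω : Fin 3 → ℕ → ℝ ↦ ω 2 1 := by fun_prop
    refine ⟨(Nat.measurable_floor.comp hm).aemeasurable, ?_⟩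
    have h : Q.map (fun ω ↦ ω 2 1) = ρ := (hlaw 2 1).map_eq
    rw [← map_floor_map_natCast (poissonMeasure Λ.toNNReal), ← hρ, ← h,
      Measure.map_map Nat.measurable_floor hm]
    rfl
  have hm₁ : Measurable fun x : ℕ → ℝ ↦ σ * Real.sqrt (x 1) * x 0 := by fun_prop
  have hm₂ : Measurable fun x : ℕ → ℝ ↦ σ * Real.sqrt (rowSum x) * x 0 :=
    (measurable_rowSum.sqrt.const_mul σ).mul (measurable_pi_apply 0)
  have hN₁m : Measurable fun ω : Fin 3 → ℕ → ℝ ↦ σ * Real.sqrt (ω 1 1) * ω 1 0 := by fun_prop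
  have hN₂m : Measurable fun ω : Fin 3 → ℕ → ℝ ↦ σ * Real.sqrt (rowSum (ω 2)) * ω 2 0 :=
    hm₂.comp (measurable_pi_apply 2)
  have hrow := iIndepFun_rows_blockMeasure (μ₀ := P.map N₀) (ν := ν) (ρ := ρ)
    (κ := jumpLaw α β w) (f := fun x ↦ a * x 0) (by fun_prop) hm₁ hm₂
  have hcf₁ := integral_cexp_row_one (μ₀ := P.map N₀) (ρ := ρ) (κ := jumpLaw α β w) (σ := σ)
    hα0 hα1 (div_pos hβ hw0) hν
  have hcf₂ := integral_cexp_row_two (σ := σ) hKlaw (ae_jumpLaw_nonneg α β w)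
  rw [Real.coe_toNNReal _ hΛ.le] at hcf₂
  have h00 : Measurable fun ω : Fin 3 → ℕ → ℝ ↦ ω 0 0 := by fun_prop
  have h11 : Measurable fun ω : Fin 3 → ℕ → ℝ ↦ ω 1 1 := by fun_prop
  refine ⟨Fin 3 → ℕ → ℝ, inferInstance, Q, fun ω ↦ ω 0 0,
    fun ω ↦ σ * Real.sqrt (ω 1 1) * ω 1 0, fun ω ↦ σ * Real.sqrt (rowSum (ω 2)) * ω 2 0,
    fun ω ↦ ω 1 0, fun ω ↦ ω 1 1, fun ω ↦ ω 2 0, fun ω ↦ rowSum (ω 2), fun ω ↦ ⌊ω 2 1⌋₊,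
    fun k ω ↦ ω 2 (k + 2), inferInstance, ⟨h00.aemeasurable, hN₀, (hlaw 0 0).map_eq⟩, hrow, ?_,
    iIndepFun_blocks, fun ω ↦ rfl, hlaw 1 0, h11.aemeasurable, ?_, ?_, fun ω ↦ rfl, hlaw 2 0,
    fun ω ↦ rfl, hKlaw, fun k ↦ hlaw 2 (k + 2)⟩
  · have hsm : Measurable fun ω : Fin 3 → ℕ → ℝ ↦ a * ω 0 0 + σ * Real.sqrt (ω 1 1) * ω 1 0 +
        σ * Real.sqrt (rowSum (ω 2)) * ω 2 0 := ((h00.const_mul a).add hN₁m).add hN₂m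
    have hNm := hN.aemeasurable t
    refine ⟨hNm, hsm.aemeasurable, ?_⟩
    have := Measure.isProbabilityMeasure_map hNm
    have := Measure.isProbabilityMeasure_map (μ := Q) hsm.aemeasurable
    refine Measure.ext_of_charFun (funext fun u ↦ ?_)
    rw [charFun_apply_real, charFun_apply_real, integral_map hNm (by fun_prop),
      integral_map hsm.aemeasurable (by fun_prop)]
    have h1 := hN.integral_cexp hα0 hα1 hβ hY hN₀ hindep t u
    have h2 := hrow.integral_cexp_add_three (h00.const_mul a) hN₁m hN₂m u
    have h3 : ∫ ω, Complex.exp (((u * (a * N₀ ω) : ℝ) : ℂ) * Complex.I) ∂P =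
        ∫ ω, Complex.exp (((u * (a * ω 0 0) : ℝ) : ℂ) * Complex.I) ∂Q := by
      have h4 : P.map N₀ = Q.map (fun ω ↦ ω 0 0) := (hlaw 0 0).map_eq.symm
      have h5 := integral_map (μ := P) hN₀ (f := fun x ↦ Complex.exp (((u * (a * x) : ℝ) : ℂ) *
        Complex.I)) (by fun_prop)
      rw [← h5, h4, integral_map h00.aemeasurable (by fun_prop)]
    rw [integral_tsExponent_eq_add (c := c) hα0 hα1 hβ hb (by positivity) (NNReal.coe_pos.2 ht)
      hwexp, ← ha, h3] at h1
    rw [hcf₁, hcf₂, mul_assoc, ← Complex.ofReal_mul, ← Real.exp_add, ← neg_add] at h2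
    simp only [Complex.ofReal_mul] at h1 h2 ⊢
    exact h1.trans h2.symm
  · have h : Q.map (fun ω ↦ ω 1 1) = ν := (hlaw 1 1).map_eq
    rw [h]
    exact hν
  · refine hSNTS _ (Measure.isProbabilityMeasure_map hN₁m.aemeasurable) fun u ↦ ?_
    rw [charFun_apply_real, integral_map hN₁m.aemeasurable (by fun_prop), ← hcf₁ u]
    simp only [Complex.ofReal_mul]
    rfl
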